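/- Let $n\in\mathbb N$, $\Lambda>1$ and $K\ge 0$. There exist constants $C,\beta_0,R_0>0$, depending only on $n,\Lambda,K$, such that the following holds for all $\beta\ge\beta_0$, all $0<R\le R_0$ and all $T>0$. Write $B_R=\{x\in\mathbb R^n:|x|<R\}$ and $Q=B_R\times(-T,T)$. Let $A=(a_{ij})$ be a function on $Q$ whose values are real symmetric $n\times n$ matrices, with $$\Lambda^{-1}I\le A(x,t)\le\Lambda I,\qquad |a_{ij}(x,t)-a_{ij}(y,s)|\le K\,(|x-y|+|t-s|)$$ for all $(x,t),(y,s)\in Q$ and all $i,j$. Put $\mathcal L u=\operatorname{div}(A(x,t)\nabla u)$, where $\operatorname{div}$ and $\nabla$ are taken in $x$ (so $\mathcal Lu$ is defined almost everywhere), and $$\sigma(x,t)=\langle A(0,t)^{-1}x,x\rangle^{1/2}.$$ Then for every $u\in C_0^\infty\big((B_R\setminus\{0\})\times(-T,T)\big)$ the three integrals below converge and $$\beta^3\int_Q\sigma^{-n}e^{\beta(\log\sigma)^2}u^2\,dx\,dt+\beta\int_Q\sigma^{-n+2}e^{\beta(\log\sigma)^2}\langle A\nabla u,\nabla u\rangle\,dx\,dt\le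 C\int_Q\sigma^{-n+4}e^{\beta(\log\sigma)^2}\,(\mathcal Lu-\partial_tu)^2\,dx\,dt.$$ -/

import Mathlib

open MeasureTheory Set Metric
open scoped ContDiff

noncomputable section

namespace ParabolicCarleman

/-- Space `ℝⁿ` with its Euclidean norm. -/
abbrev Space (n : ℕ) := EuclideanSpace ℝ (Fin n)

/-- The space-time cylinder `B_R × (-T, T)`. -/
def spaceTimeCylinder (n : ℕ) (R T : ℝ) : Set (Space n × ℝ) := ball 0 R ×ˢ Ioo (-T) T

/-- The uniform ellipticity `Λ⁻¹ I ≤ A(x,t) ≤ Λ I` on `S`, in the Loewner order of real symmetric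
matrices (`Matrix.PosSemidef` includes symmetry, so each `A(x,t)` is symmetric). -/
def UniformlyElliptic {n : ℕ} (Λ : ℝ) (A : Space n × ℝ → Matrix (Fin n) (Fin n) ℝ)
    (S : Set (Space n × ℝ)) : Prop :=
  ∀ p ∈ S, (A p - Λ⁻¹ • (1 : Matrix (Fin n) (Fin n) ℝ)).PosSemidef ∧
    (Λ • (1 : Matrix (Fin n) (Fin n) ℝ) - A p).PosSemidef

/-- The Lipschitz bound `|a_ij(x,t) - a_ij(y,s)| ≤ K (|x - y| + |t - s|)` on `S`, entry by entry. -/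
def LipschitzCoefficients {n : ℕ} (K : ℝ) (A : Space n × ℝ → Matrix (Fin n) (Fin n) ℝ)
    (S : Set (Space n × ℝ)) : Prop :=
  ∀ p ∈ S, ∀ q ∈ S, ∀ i j, |A p i j - A q i j| ≤ K * (‖p.1 - q.1‖ + |p.2 - q.2|)

/-- The gradient `∇u(x,t)` in the space variable. -/
def spaceGrad {n : ℕ} (u : Space n × ℝ → ℝ) (p : Space n × ℝ) : Space n :=
  gradient (fun y => u (y, p.2)) p.1

/-- The derivative `∂ₜu(x,t)`. -/
def timeDeriv {n : ℕ} (u : Space n × ℝ → ℝ) (p : Space n × ℝ) : ℝ :=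
  deriv (fun s => u (p.1, s)) p.2

/-- The vector field `A∇u`. -/
def flux {n : ℕ} (A : Space n × ℝ → Matrix (Fin n) (Fin n) ℝ) (u : Space n × ℝ → ℝ)
    (p : Space n × ℝ) : Space n :=
  WithLp.toLp 2 (Matrix.mulVec (A p) (WithLp.ofLp (spaceGrad u p)))

/-- The divergence `∑ᵢ ∂ᵢ Fᵢ` in the space variable. For a field that is Lipschitz in `x` the
partial derivatives exist almost everywhere. -/
def spaceDiv {n : ℕ} (F : Space n × ℝ → Space n) (p : Space n × ℝ) : ℝ :=
  ∑ i : Fin n, lineDeriv ℝ (fun y => F (y, p.2) i) p.1 (EuclideanSpace.single i 1)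

/-- The operator `ℒu = div(A∇u)`. -/
def divOp {n : ℕ} (A : Space n × ℝ → Matrix (Fin n) (Fin n) ℝ) (u : Space n × ℝ → ℝ) :
    Space n × ℝ → ℝ :=
  spaceDiv (flux A u)

/-- The function `σ(x,t) = ⟨A(0,t)⁻¹ x, x⟩^{1/2}`. -/
def sigma {n : ℕ} (A : Space n × ℝ → Matrix (Fin n) (Fin n) ℝ) (p : Space n × ℝ) : ℝ :=
  Real.sqrt (dotProduct (Matrix.mulVec (A (0, p.2))⁻¹ (WithLp.ofLp p.1)) (WithLp.ofLp p.1))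

/-- The weight `σ^{-n+k} e^{β (log σ)²}`. -/
def weight {n : ℕ} (A : Space n × ℝ → Matrix (Fin n) (Fin n) ℝ) (β : ℝ) (k : ℤ)
    (p : Space n × ℝ) : ℝ :=
  sigma A p ^ (-(n : ℤ) + k) * Real.exp (β * Real.log (sigma A p) ^ 2)

end ParabolicCarleman

end

open ParabolicCarleman

/-!
# A Carleman estimate for parabolic operators with Lipschitz coefficients

Write `s = log σ`, `G(t) = A(0,t)⁻¹`, `v = e^{β s² / 2} u`. Conjugating `σ² (ℒ - ∂ₜ)` by the weight
gives `S + B + E` applied to `v`, where, with the radial field `Y = σ² A ∇s = A G x`,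
* `S = σⁿ div(σ^{2-n} A ∇v) + β² s² ⟨A∇σ, ∇σ⟩ v` is the leading symmetric part for the measure
  `σ⁻ⁿ dx dt`,
* `B = -2 β s ⟨Y, ∇v⟩ - σ² e^{β s² / 2} ∂ₜu` is the leading antisymmetric part, and
* `E` consists of lower-order terms (`conjugated_operator`).

The product `(B - 2βv) S` is a space-time divergence up to quadratic terms
(`divergence_carlemanField`). Near the origin `Y` is the Euler field `x` up to `O(|x|²)` and
`⟨A∇σ, ∇σ⟩` is `1` up to `O(|x|)`. The terms that would vanish for constant coefficients are
therefore bounded by `|x| |log σ|` times the terms to be estimated, and this factor is small on small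
balls (`BoundedAt.abs_carlemanError_le`). The convexity of `s ↦ β s²` makes the `v²`-term positive of
size `β³ s²`. The multiplier `-2βv` exchanges part of it for positivity of the gradient term. The
mixed term `2 ⟨Y, ∇v⟩ σ² ∂ₜu` that the time dependence produces is rewritten through `B` itself, and
its remainder has a good sign because `s < 0`. This yields the estimate pointwise almost everywhere
up to a divergence (`carleman_pointwise`).

Since `∂ₜσ` is merely bounded, the time derivative is kept on `u` and not on `v`: then the field
whose divergence occurs is Lipschitz with compact support, its components are differentiable almost
everywhere by Rademacher's theorem, and its divergence integrates to zero
(`integral_divergence_add_eq_zero`). The coefficients, given on the cylinder only, are first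
replaced by global Lipschitz extensions (`carleman_of_extension`). These need not be elliptic off
the cylinder, which does not matter because all terms vanish off the support of `u`.
-/

noncomputable section

set_option linter.unusedSectionVars false

namespace ParabolicCarleman

open Filter Topology

/-! ### Local Lipschitz continuity and derivatives at a point -/

section Toolbox

variable {X V W U : Type*} [NormedAddCommGroup X] [NormedSpace ℝ X]
  [NormedAddCommGroup V] [NormedSpace ℝ V] [NormedAddCommGroup W] [NormedSpace ℝ W]
  [NormedAddCommGroup U] [NormedSpace ℝ U]

/-- `f` is Lipschitz on some neighbourhood of `p`. -/
def LipschitzNear (f : X → V) (p : X) : Prop :=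
  ∃ K : NNReal, ∃ s ∈ 𝓝 p, LipschitzOnWith K f s

namespace LipschitzNear

variable {f : X → V} {g : X → W} {p : X}

theorem continuousAt (hf : LipschitzNear f p) : ContinuousAt f p := by
  obtain ⟨K, s, hs, h⟩ := hf
  exact h.continuousOn.continuousAt hs

theorem of_contDiffAt (hf : ContDiffAt ℝ 1 f p) : LipschitzNear f p :=
  hf.exists_lipschitzOnWith

theorem of_contDiff (hf : ContDiff ℝ ∞ f) : LipschitzNear f p :=
  of_contDiffAt (hf.contDiffAt.of_le (by exact_mod_cast le_top))

theorem of_lipschitzWith {K : NNReal} (hf : LipschitzWith K f) : LipschitzNear f p :=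
  ⟨K, univ, univ_mem, hf.lipschitzOnWith⟩

theorem comp {g : V → W} (hg : ContDiffAt ℝ 1 g (f p)) (hf : LipschitzNear f p) :
    LipschitzNear (fun x => g (f x)) p := by
  obtain ⟨K, s, hs, h⟩ := id hf
  obtain ⟨K', t, ht, h'⟩ := hg.exists_lipschitzOnWith
  refine ⟨K' * K, s ∩ f ⁻¹' t, inter_mem hs (hf.continuousAt ht), ?_⟩
  exact h'.comp (h.mono inter_subset_left) (fun x hx => hx.2)

theorem prodMk (hf : LipschitzNear f p) (hg : LipschitzNear g p) :
    LipschitzNear (fun x => (f x, g x)) p := by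
  obtain ⟨K, s, hs, h⟩ := hf
  obtain ⟨K', t, ht, h'⟩ := hg
  exact ⟨max K K', s ∩ t, inter_mem hs ht,
    (h.mono inter_subset_left).prodMk (h'.mono inter_subset_right)⟩

theorem comp₂ {F : V × W → U} (hF : ContDiff ℝ 1 F) (hf : LipschitzNear f p)
    (hg : LipschitzNear g p) : LipschitzNear (fun x => F (f x, g x)) p :=
  comp (g := F) hF.contDiffAt (hf.prodMk hg)

theorem add {g : X → V} (hf : LipschitzNear f p) (hg : LipschitzNear g p) :
    LipschitzNear (fun x => f x + g x) p :=
  comp₂ (F := fun z : V × V => z.1 + z.2) (by fun_prop) hf hg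

theorem sub {g : X → V} (hf : LipschitzNear f p) (hg : LipschitzNear g p) :
    LipschitzNear (fun x => f x - g x) p :=
  comp₂ (F := fun z : V × V => z.1 - z.2) (by fun_prop) hf hg

theorem smul {f : X → ℝ} (hf : LipschitzNear f p) (hg : LipschitzNear g p) :
    LipschitzNear (fun x => f x • g x) p :=
  comp₂ (F := fun z : ℝ × W => z.1 • z.2) (by fun_prop) hf hg

theorem mul {f g : X → ℝ} (hf : LipschitzNear f p) (hg : LipschitzNear g p) :
    LipschitzNear (fun x => f x * g x) p := smul hf hg

theorem clm_apply {f : X → V →L[ℝ] W} {g : X → V} (hf : LipschitzNear f p)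
    (hg : LipschitzNear g p) : LipschitzNear (fun x => f x (g x)) p :=
  comp₂ (F := fun z : (V →L[ℝ] W) × V => z.1 z.2) (by fun_prop) hf hg

theorem inner {E : Type*} [NormedAddCommGroup E] [InnerProductSpace ℝ E] {f g : X → E}
    (hf : LipschitzNear f p) (hg : LipschitzNear g p) :
    LipschitzNear (fun x => inner ℝ (f x) (g x)) p :=
  comp₂ (F := fun z : E × E => Inner.inner ℝ z.1 z.2) contDiff_inner hf hg

theorem const (c : V) : LipschitzNear (fun _ : X => c) p :=
  ⟨0, univ, univ_mem, (LipschitzWith.const c).lipschitzOnWith⟩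

theorem exp {f : X → ℝ} (hf : LipschitzNear f p) : LipschitzNear (fun x => Real.exp (f x)) p :=
  comp Real.contDiff_exp.contDiffAt hf

theorem pow {f : X → ℝ} (hf : LipschitzNear f p) (k : ℕ) : LipschitzNear (fun x => f x ^ k) p :=
  comp (g := fun y : ℝ => y ^ k) (by fun_prop) hf

theorem log {f : X → ℝ} (hf : LipschitzNear f p) (h0 : f p ≠ 0) :
    LipschitzNear (fun x => Real.log (f x)) p :=
  comp (Real.contDiffAt_log.2 h0) hf

theorem congr {g : X → V} (hf : LipschitzNear f p) (h : f =ᶠ[𝓝 p] g) : LipschitzNear g p := by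
  obtain ⟨K, s, hs, hL⟩ := hf
  refine ⟨K, s ∩ {x | f x = g x}, inter_mem hs h, ?_⟩
  intro x hx y hy
  rw [← hx.2, ← hy.2]
  exact hL hx.1 hy.1

/-- A locally Lipschitz function of compact support is globally Lipschitz. -/
theorem exists_lipschitzWith [FiniteDimensional ℝ X] (hf : ∀ p, LipschitzNear f p)
    (hc : HasCompactSupport f) : ∃ K, LipschitzWith K f := by
  have := FiniteDimensional.proper ℝ X
  obtain ⟨r, hr⟩ := hc.isCompact.isBounded.subset_closedBall (0 : X)
  have hloc : LocallyLipschitz f := hf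
  obtain ⟨K, hK⟩ := (hloc.locallyLipschitzOn
    (s := closedBall (0 : X) (r + 1))).exists_lipschitzOnWith_of_compact
      (isCompact_closedBall _ _)
  obtain ⟨M, hM⟩ := hc.exists_bound_of_continuous hloc.continuous
  have hM0 : 0 ≤ M := (norm_nonneg _).trans (hM 0)
  have hout : ∀ y, y ∉ closedBall (0 : X) r → f y = 0 := fun y hy =>
    image_eq_zero_of_notMem_tsupport fun h => hy (hr h)
  -- A point of the support and a point outside the larger ball are at distance at least `1`.
  have key : ∀ x y, x ∈ closedBall (0 : X) (r + 1) → y ∉ closedBall (0 : X) (r + 1) →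
      dist (f x) (f y) ≤ max K (M.toNNReal) * dist x y := by
    intro x y hx hy
    have hy0 : f y = 0 := hout y fun h => hy (closedBall_subset_closedBall (by linarith) h)
    by_cases hxr : x ∈ closedBall (0 : X) r
    · have h1 : 1 ≤ dist x y := by
        simp only [mem_closedBall, dist_zero_right, not_le] at hxr hy
        have := norm_sub_norm_le y x
        rw [dist_comm, dist_eq_norm]
        linarith
      have h2 : dist (f x) (f y) ≤ M := by rw [hy0, dist_zero_right]; exact hM x
      have h3 : M ≤ ((max K M.toNNReal : NNReal) : ℝ) := by
        rw [NNReal.coe_max, Real.coe_toNNReal _ hM0]; exact le_max_right _ _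
      nlinarith
    · rw [hout x hxr, hy0, dist_self]; positivity
  refine ⟨max K M.toNNReal, LipschitzWith.of_dist_le_mul fun x y => ?_⟩
  by_cases hx : x ∈ closedBall (0 : X) (r + 1) <;> by_cases hy : y ∈ closedBall (0 : X) (r + 1)
  · refine (hK.dist_le_mul x hx y hy).trans ?_
    gcongr
    exact le_max_left _ _
  · exact key x y hx hy
  · rw [dist_comm, dist_comm x]; exact key y x hy hx
  · rw [hout x fun h => hx (closedBall_subset_closedBall (by linarith) h),
      hout y fun h => hy (closedBall_subset_closedBall (by linarith) h), dist_self]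
    positivity

end LipschitzNear

/-- `f` is differentiable at `p` and its derivative there is the function `F`. The derivative is
recorded as a bare function so that the rules below compute it in closed form. -/
def DerivativeAt (f : X → V) (p : X) (F : X → V) : Prop :=
  ∃ f' : X →L[ℝ] V, HasFDerivAt f f' p ∧ ∀ w, f' w = F w

namespace DerivativeAt

variable {f : X → V} {F : X → V} {p : X}

theorem fderiv_apply (h : DerivativeAt f p F) (w : X) : fderiv ℝ f p w = F w := by
  obtain ⟨f', h1, h2⟩ := h
  rw [h1.fderiv, h2]

theorem differentiableAt (h : DerivativeAt f p F) : DifferentiableAt ℝ f p := by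
  obtain ⟨f', h1, h2⟩ := h
  exact h1.differentiableAt

theorem of_differentiableAt (h : DifferentiableAt ℝ f p) : DerivativeAt f p (fderiv ℝ f p) :=
  ⟨_, h.hasFDerivAt, fun _ => rfl⟩

theorem congr_deriv {F' : X → V} (h : DerivativeAt f p F) (hF : ∀ w, F w = F' w) :
    DerivativeAt f p F' := by
  obtain ⟨f', h1, h2⟩ := h
  exact ⟨f', h1, fun w => (h2 w).trans (hF w)⟩

theorem const (c : V) : DerivativeAt (fun _ : X => c) p (fun _ => 0) :=
  ⟨0, hasFDerivAt_const _ _, fun _ => rfl⟩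

theorem add {g : X → V} {G : X → V} (hf : DerivativeAt f p F) (hg : DerivativeAt g p G) :
    DerivativeAt (fun x => f x + g x) p (fun w => F w + G w) := by
  obtain ⟨f', h1, h2⟩ := hf
  obtain ⟨g', h3, h4⟩ := hg
  exact ⟨f' + g', h1.add h3, fun w => by simp [h2, h4]⟩

theorem sub {g : X → V} {G : X → V} (hf : DerivativeAt f p F) (hg : DerivativeAt g p G) :
    DerivativeAt (fun x => f x - g x) p (fun w => F w - G w) := by
  obtain ⟨f', h1, h2⟩ := hf
  obtain ⟨g', h3, h4⟩ := hg
  exact ⟨f' - g', h1.sub h3, fun w => by simp [h2, h4]⟩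

theorem smul {c : X → ℝ} {c' : X → ℝ} (hc : DerivativeAt c p c') (hf : DerivativeAt f p F) :
    DerivativeAt (fun x => c x • f x) p (fun w => c' w • f p + c p • F w) := by
  obtain ⟨f', h1, h2⟩ := hf
  obtain ⟨g', h3, h4⟩ := hc
  exact ⟨_, h3.smul h1, fun w => by simp [h2, h4, add_comm]⟩

theorem mul {c d : X → ℝ} {c' d' : X → ℝ} (hc : DerivativeAt c p c') (hd : DerivativeAt d p d') :
    DerivativeAt (fun x => c x * d x) p (fun w => c' w * d p + c p * d' w) := smul hc hd

theorem const_mul {d : X → ℝ} {d' : X → ℝ} (c : ℝ) (hd : DerivativeAt d p d') :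
    DerivativeAt (fun x => c * d x) p (fun w => c * d' w) :=
  ((const c).mul hd).congr_deriv fun w => by simp

theorem clm_apply {f : X → V →L[ℝ] W} {F : X → V →L[ℝ] W} {g G : X → V}
    (hf : DerivativeAt f p F) (hg : DerivativeAt g p G) :
    DerivativeAt (fun x => f x (g x)) p (fun w => F w (g p) + f p (G w)) := by
  obtain ⟨f', h1, h2⟩ := hf
  obtain ⟨g', h3, h4⟩ := hg
  exact ⟨_, h1.clm_apply h3, fun w => by simp [h2, h4, add_comm]⟩

theorem inner {E : Type*} [NormedAddCommGroup E] [InnerProductSpace ℝ E] {f g F G : X → E}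
    (hf : DerivativeAt f p F) (hg : DerivativeAt g p G) :
    DerivativeAt (fun x => inner ℝ (f x) (g x)) p
      (fun w => inner ℝ (F w) (g p) + inner ℝ (f p) (G w)) := by
  obtain ⟨f', h1, h2⟩ := hf
  obtain ⟨g', h3, h4⟩ := hg
  exact ⟨_, h1.inner ℝ h3, fun w => by simp [h2, h4, add_comm]⟩

theorem exp {c : X → ℝ} {c' : X → ℝ} (hc : DerivativeAt c p c') :
    DerivativeAt (fun x => Real.exp (c x)) p (fun w => Real.exp (c p) * c' w) := by
  obtain ⟨g', h3, h4⟩ := hc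
  exact ⟨_, h3.exp, fun w => by simp [h4]⟩

theorem log {c : X → ℝ} {c' : X → ℝ} (hc : DerivativeAt c p c') (h0 : c p ≠ 0) :
    DerivativeAt (fun x => Real.log (c x)) p (fun w => (c p)⁻¹ * c' w) := by
  obtain ⟨g', h3, h4⟩ := hc
  exact ⟨_, h3.log h0, fun w => by simp [h4]⟩

end DerivativeAt

end Toolbox

/-! ### Divergence and the integral of a divergence -/

section Divergence

variable {n : ℕ}

/-- The divergence in the space variable of a field on space-time, through its Fréchet
derivative. -/
def divergence (Z : Space n × ℝ → Space n) (p : Space n × ℝ) : ℝ :=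
  ∑ i : Fin n, fderiv ℝ Z p (EuclideanSpace.single i 1, 0) i

instance : (volume : Measure (Space n × ℝ)).IsAddHaarMeasure :=
  inferInstanceAs ((volume : Measure (Space n)).prod (volume : Measure ℝ)).IsAddHaarMeasure

theorem sum_coord_smul_single (z : Space n) :
    ∑ i : Fin n, z i • ((EuclideanSpace.single i (1 : ℝ) : Space n), (0 : ℝ)) = (z, 0) := by
  have h : ∑ i : Fin n, z i • (EuclideanSpace.single i (1 : ℝ) : Space n) = z := by
    ext j
    simp [Finset.sum_apply, Pi.single_apply]
  refine Prod.ext ?_ ?_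
  · rw [Prod.fst_sum]; exact h
  · rw [Prod.snd_sum]; simp

theorem divergence_smul {f : Space n × ℝ → ℝ} {F : Space n × ℝ → ℝ}
    {Z : Space n × ℝ → Space n} {p : Space n × ℝ}
    (hf : DerivativeAt f p F) (hZ : DifferentiableAt ℝ Z p) :
    divergence (fun x => f x • Z x) p = f p * divergence Z p + F (Z p, 0) := by
  have h := (hf.smul (DerivativeAt.of_differentiableAt hZ)).fderiv_apply
  obtain ⟨f', h1, h2⟩ := hf
  simp only [divergence, h]
  simp only [PiLp.add_apply, PiLp.smul_apply, smul_eq_mul, Finset.sum_add_distrib,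
    ← Finset.mul_sum]
  rw [add_comm]
  congr 1
  rw [← h2, ← sum_coord_smul_single (Z p), map_sum]
  refine Finset.sum_congr rfl fun i _ => ?_
  rw [map_smul, h2, smul_eq_mul, mul_comm]

theorem divergence_sub {Z Z' : Space n × ℝ → Space n} {p : Space n × ℝ}
    (hZ : DifferentiableAt ℝ Z p) (hZ' : DifferentiableAt ℝ Z' p) :
    divergence (fun x => Z x - Z' x) p = divergence Z p - divergence Z' p := by
  have h := ((DerivativeAt.of_differentiableAt hZ).sub
    (DerivativeAt.of_differentiableAt hZ')).fderiv_apply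
  simp only [divergence, h]
  simp

theorem integral_lineDeriv_eq_zero {X : Type*} [NormedAddCommGroup X] [NormedSpace ℝ X]
    [FiniteDimensional ℝ X] [MeasurableSpace X] [BorelSpace X] (μ : Measure X)
    [μ.IsAddHaarMeasure] {K : NNReal} {f : X → ℝ} (hf : LipschitzWith K f)
    (hc : HasCompactSupport f) (v : X) : ∫ x, lineDeriv ℝ f x v ∂μ = 0 := by
  have h := (LipschitzWith.const (1 : ℝ)).integral_lineDeriv_mul_eq (μ := μ) (D := K) (g := f)
    (E := X) hf hc (-v)
  simpa [lineDeriv] using h.symm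

theorem integrable_fderiv_apply {X V : Type*} [NormedAddCommGroup X] [NormedSpace ℝ X]
    [FiniteDimensional ℝ X] [MeasurableSpace X] [BorelSpace X] (μ : Measure X)
    [μ.IsAddHaarMeasure] [NormedAddCommGroup V] [NormedSpace ℝ V] [FiniteDimensional ℝ V]
    {f : X → V} (hf : ∀ p, LipschitzNear f p)
    (hc : HasCompactSupport f) (v : X) :
    Integrable (fun x => fderiv ℝ f x v) μ := by
  obtain ⟨K, hK⟩ := LipschitzNear.exists_lipschitzWith hf hc
  have := FiniteDimensional.complete ℝ V
  let _ : MeasurableSpace V := borel V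
  have : BorelSpace V := ⟨rfl⟩
  have : IsFiniteMeasure (μ.restrict (tsupport f)) :=
    ⟨by rw [Measure.restrict_apply_univ]; exact hc.isCompact.measure_lt_top⟩
  have hm : Measurable fun x => fderiv ℝ f x v := measurable_fderiv_apply_const ℝ f v
  have h1 : IntegrableOn (fun x => fderiv ℝ f x v) (tsupport f) μ := by
    refine Integrable.of_bound (C := K * ‖v‖) hm.aestronglyMeasurable ?_
    refine Eventually.of_forall fun x => ?_
    exact (fderiv ℝ f x).le_of_opNorm_le (norm_fderiv_le_of_lipschitz ℝ hK) v
  refine (integrableOn_iff_integrable_of_support_subset ?_).1 h1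
  intro x hx
  by_contra hx'
  apply hx
  have : fderiv ℝ f x = 0 := by
    by_contra h0
    exact hx' (support_fderiv_subset ℝ h0)
  simp [this]

theorem integral_fderiv_eq_zero {X : Type*} [NormedAddCommGroup X] [NormedSpace ℝ X]
    [FiniteDimensional ℝ X] [MeasurableSpace X] [BorelSpace X] (μ : Measure X)
    [μ.IsAddHaarMeasure] {f : X → ℝ} (hf : ∀ p, LipschitzNear f p)
    (hc : HasCompactSupport f) (v : X) : ∫ x, fderiv ℝ f x v ∂μ = 0 := by
  obtain ⟨K, hK⟩ := LipschitzNear.exists_lipschitzWith hf hc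
  rw [← integral_lineDeriv_eq_zero μ hK hc v]
  refine integral_congr_ae ?_
  filter_upwards [hK.ae_differentiableAt (μ := μ)] with x hx
  exact hx.lineDeriv_eq_fderiv.symm

/-- The space-time divergence theorem without boundary terms: a compactly supported Lipschitz field
`(Z, T)` has an integrable divergence of integral zero. -/
theorem integral_divergence_add_eq_zero {Z : Space n × ℝ → Space n} {T : Space n × ℝ → ℝ}
    (hZ : ∀ p, LipschitzNear Z p) (hZc : HasCompactSupport Z)
    (hT : ∀ p, LipschitzNear T p) (hTc : HasCompactSupport T) :
    Integrable (fun p => divergence Z p + fderiv ℝ T p (0, 1)) ∧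
      ∫ p, (divergence Z p + fderiv ℝ T p (0, 1)) = 0 := by
  obtain ⟨K, hK⟩ := LipschitzNear.exists_lipschitzWith hZ hZc
  have hlin : ∀ i : Fin n, ContDiff ℝ 1 (fun z : Space n => z i) := fun i => by fun_prop
  have hZi : ∀ i p, LipschitzNear (fun x => Z x i) p := fun i p =>
    LipschitzNear.comp (hlin i).contDiffAt (hZ p)
  have hZic : ∀ i, HasCompactSupport fun x => Z x i := fun i =>
    hZc.comp_left (g := fun z : Space n => z i) rfl
  have hi : ∀ i : Fin n, Integrable fun p =>
      fderiv ℝ (fun x => Z x i) p ((EuclideanSpace.single i 1 : Space n), (0 : ℝ)) := fun i =>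
    integrable_fderiv_apply volume (hZi i) (hZic i) _
  have hTi : Integrable fun p => fderiv ℝ T p ((0 : Space n), (1 : ℝ)) :=
    integrable_fderiv_apply volume hT hTc _
  have hae : (fun p => divergence Z p + fderiv ℝ T p (0, 1)) =ᵐ[volume] fun p =>
      (∑ i : Fin n, fderiv ℝ (fun x => Z x i) p
        ((EuclideanSpace.single i 1 : Space n), (0 : ℝ))) + fderiv ℝ T p (0, 1) := by
    filter_upwards [hK.ae_differentiableAt] with x hx
    unfold divergence
    congr 1
    refine Finset.sum_congr rfl fun i _ => ?_
    have h := (EuclideanSpace.proj i : Space n →L[ℝ] ℝ).hasFDerivAt.comp x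
      hx.hasFDerivAt
    have h' : fderiv ℝ (fun y => Z y i) x = _ := h.fderiv
    rw [h']
    rfl
  refine ⟨((integrable_finsetSum _ fun i _ => hi i).add hTi).congr hae.symm, ?_⟩
  rw [integral_congr_ae hae, integral_add (integrable_finsetSum _ fun i _ => hi i) hTi,
    integral_finsetSum _ fun i _ => hi i, integral_fderiv_eq_zero volume hT hTc,
    Finset.sum_eq_zero fun i _ => integral_fderiv_eq_zero volume (hZi i) (hZic i) _, add_zero]

end Divergence

/-! ### The divergence identity for abstract fields -/

variable {n : ℕ}

theorem DerivativeAt.map_smul_fst {V : Type*} [NormedAddCommGroup V] [NormedSpace ℝ V]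
    {f F : Space n × ℝ → V} {p : Space n × ℝ} (h : DerivativeAt f p F) (c : ℝ) (z : Space n) :
    F (c • z, 0) = c • F (z, 0) := by
  obtain ⟨f', _, h2⟩ := h
  rw [← h2, ← h2, ← map_smul]
  simp

/-- The Rellich-type identity behind the estimate, for abstract fields at a point. The roles are
`s = log σ`, `Y` the radial field, `q = ⟨A∇σ, ∇σ⟩`, `v` the conjugated function, `g = ∇v`, `D` the
conjugated time derivative and `κ` the time derivative of the gradient of the weight. The second
derivatives of `v` cancel by the symmetry of the Hessian; the terms with `v D` and `v ⟨Y, g⟩` cancel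
against the zeroth-order part of the symmetric operator. -/
theorem divergence_identity
    {A : Space n × ℝ → Space n →L[ℝ] Space n} {s q v D : Space n × ℝ → ℝ}
    {Y g : Space n × ℝ → Space n} {p : Space n × ℝ}
    {A' : Space n × ℝ → Space n →L[ℝ] Space n} {s' q' v' D' : Space n × ℝ → ℝ}
    {Y' g' : Space n × ℝ → Space n} (β : ℝ) (κ : Space n)
    (hA : DerivativeAt A p A') (hs : DerivativeAt s p s') (hq : DerivativeAt q p q')
    (hv : DerivativeAt v p v') (hD : DerivativeAt D p D') (hY : DerivativeAt Y p Y')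
    (hg : DerivativeAt g p g')
    (symA : ∀ ξ η, inner ℝ (A p ξ) η = inner ℝ (A p η) ξ)
    (symH : ∀ ξ η, inner ℝ (g' (ξ, 0)) η = inner ℝ (g' (η, 0)) ξ)
    (hsA : s' (A p (g p), 0) = Real.exp (-2 * s p) * inner ℝ (Y p) (g p))
    (hsY : s' (Y p, 0) = q p)
    (hvx : ∀ ξ, v' (ξ, 0) = inner ℝ (g p) ξ)
    (hvt : v' (0, 1) = D p + β * s p * s' (0, 1) * v p)
    (hDg : ∀ ξ, inner ℝ (g' (0, 1)) ξ =
      D' (ξ, 0) + β * s p * s' (0, 1) * inner ℝ (g p) ξ + v p * inner ℝ κ ξ) :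
    divergence (fun x => ((-2 * β) * s x * inner ℝ (Y x) (g x) - Real.exp (2 * s x) * D x
          - 2 * β * v x) •
          ((Real.exp (-n * s x) * Real.exp (2 * s x)) • A x (g x))
        - (-β * (s x * (Real.exp (-n * s x) * Real.exp (2 * s x)) * inner ℝ (A x (g x)) (g x))
          + β ^ 3 * (Real.exp (-n * s x) * (s x * s x * s x * (q x * (v x * v x))))) • Y x) p
      + fderiv ℝ (fun x => (1 / 2) * (Real.exp (-n * s x) * Real.exp (4 * s x)
            * inner ℝ (A x (g x)) (g x))
          - (β ^ 2 / 2) * (Real.exp (-n * s x) * Real.exp (2 * s x) * (s x * s x)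
            * (q x * (v x * v x)))) p (0, 1)
    = Real.exp (-n * s p) * (
        (-2 * β * s p * inner ℝ (Y p) (g p) - Real.exp (2 * s p) * D p - 2 * β * v p) *
          (Real.exp (n * s p) * divergence (fun x => (Real.exp (-n * s x) * Real.exp (2 * s x)) •
              A x (g x)) p + β ^ 2 * s p ^ 2 * q p * v p)
        + 2 * inner ℝ (Y p) (g p) * (-2 * β * s p * inner ℝ (Y p) (g p) - Real.exp (2 * s p) * D p)
        - (-4 * β * s p + 2 * β) * inner ℝ (Y p) (g p) ^ 2
        - β * (2 - q p) * Real.exp (2 * s p) * inner ℝ (A p (g p)) (g p)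
        - β ^ 3 * s p ^ 2 * (3 * q p ^ 2 - 2 * q p) * v p ^ 2
        + (-2 * β * s p * Real.exp (2 * s p) * (inner ℝ (Y' (A p (g p), 0)) (g p)
              - (1 / 2) * inner ℝ (A p (g p)) (g p) * divergence Y p
              - (1 / 2) * (2 - n) * q p * inner ℝ (A p (g p)) (g p)
              - (1 / 2) * inner ℝ (A' (Y p, 0) (g p)) (g p))
          + Real.exp (2 * s p) ^ 2 * (β * s p * s' (0, 1) * inner ℝ (A p (g p)) (g p)
              + v p * inner ℝ (A p (g p)) κ
              + (1 / 2) * (4 - n) * s' (0, 1) * inner ℝ (A p (g p)) (g p)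
              + (1 / 2) * inner ℝ (A' (0, 1) (g p)) (g p))
          - β ^ 3 * s p ^ 3 * v p ^ 2 * (q p * divergence Y p - n * q p ^ 2 + q' (Y p, 0))
          - (1 / 2) * β ^ 2 * Real.exp (2 * s p) * v p ^ 2 *
            ((2 - n) * s' (0, 1) * s p ^ 2 * q p + 2 * s p * s' (0, 1) * q p
              + s p ^ 2 * q' (0, 1) + 2 * β * s p ^ 3 * s' (0, 1) * q p))) := by
  have he1 : DerivativeAt (fun x => Real.exp (-n * s x)) p _ := (hs.const_mul (-(n : ℝ))).exp
  have he2 : DerivativeAt (fun x => Real.exp (2 * s x)) p _ := (hs.const_mul 2).exp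
  have he4 : DerivativeAt (fun x => Real.exp (4 * s x)) p _ := (hs.const_mul 4).exp
  have hAg := hA.clm_apply hg
  have hW := (he1.mul he2).smul hAg
  have hN := hAg.inner hg
  have hy := hY.inner hg
  have hc1 := (((hs.const_mul (-2 * β)).mul hy).sub (he2.mul hD)).sub (hv.const_mul (2 * β))
  have hqv := hq.mul (hv.mul hv)
  have hc2 := (((hs.mul (he1.mul he2)).mul hN).const_mul (-β)).add
    ((he1.mul (((hs.mul hs).mul hs).mul hqv)).const_mul (β ^ 3))
  have hT := (((he1.mul he4).mul hN).const_mul (1 / 2)).sub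
    ((((he1.mul he2).mul (hs.mul hs)).mul hqv).const_mul (β ^ 2 / 2))
  rw [hT.fderiv_apply, divergence_sub (hc1.smul hW).differentiableAt
    (hc2.smul hY).differentiableAt, divergence_smul hc1 hW.differentiableAt,
    divergence_smul hc2 hY.differentiableAt]
  have h4 : Real.exp (4 * s p) = Real.exp (2 * s p) ^ 2 := by
    rw [← Real.exp_nat_mul]; congr 1; push_cast; ring
  have hn : Real.exp (-n * s p) * Real.exp (n * s p) = 1 := by
    rw [← Real.exp_add]; simp
  have h2 : Real.exp (2 * s p) * Real.exp (-2 * s p) = 1 := by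
    rw [← Real.exp_add]; simp
  have e1 : inner ℝ (A p (g' (Y p, 0))) (g p) = inner ℝ (Y p) (g' (A p (g p), 0)) := by
    rw [symA, real_inner_comm, symH, real_inner_comm]
  have e1' : inner ℝ (A p (g p)) (g' (Y p, 0)) = inner ℝ (Y p) (g' (A p (g p), 0)) := by
    rw [real_inner_comm, symH, real_inner_comm]
  have e2 : inner ℝ (A p (g' (0, 1))) (g p) = inner ℝ (A p (g p)) (g' (0, 1)) := by
    rw [symA]
  have e3 : inner ℝ (A p (g p)) (g' (0, 1)) = D' (A p (g p), 0)
      + β * s p * s' (0, 1) * inner ℝ (A p (g p)) (g p) + v p * inner ℝ (A p (g p)) κ := by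
    rw [real_inner_comm, hDg, real_inner_comm (A p (g p)), real_inner_comm (A p (g p))]
  have e4 : inner ℝ (g p) (A p (g p)) = inner ℝ (A p (g p)) (g p) := real_inner_comm _ _
  have e5 : inner ℝ (g p) (Y p) = inner ℝ (Y p) (g p) := real_inner_comm _ _
  simp only [hs.map_smul_fst, hY.map_smul_fst, hg.map_smul_fst, hD.map_smul_fst,
    hv.map_smul_fst, hsA, hsY, hvx, hvt, inner_add_left, inner_smul_left, inner_smul_right,
    e1, e1', e2, e3, e4, e5, h4, smul_eq_mul, conj_trivial]
  generalize divergence (fun x => (Real.exp (-n * s x) * Real.exp (2 * s x)) • A x (g x)) p = δW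
  generalize divergence Y p = δ
  generalize D' (A p (g p), 0) = D1 at *
  generalize Real.exp (n * s p) = en at *
  generalize Real.exp (-n * s p) = μ at *
  generalize Real.exp (2 * s p) = a at *
  generalize Real.exp (-2 * s p) = ai at *
  generalize inner ℝ (Y p) (g p) = y at *
  generalize inner ℝ (A p (g p)) (g p) = N at *
  linear_combination (-(-2 * β * s p * y - a * D p - 2 * β * v p) * δW) * hn
    + (-2 * β * μ * y ^ 2 - 2 * a * μ * y * D p) * h2

/-! ### Derivatives of the smooth function -/

section Smooth

variable {u : Space n × ℝ → ℝ}

theorem spaceGrad_eq (hu : ContDiff ℝ ∞ u) (p : Space n × ℝ) :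
    spaceGrad u p = (InnerProductSpace.toDual ℝ (Space n)).symm
      ((fderiv ℝ u p).comp (ContinuousLinearMap.inl ℝ (Space n) ℝ)) := by
  have h1 : HasFDerivAt u (fderiv ℝ u p) (p.1, p.2) :=
    (hu.differentiable (by simp) p).hasFDerivAt
  have h2 := HasFDerivAt.comp (f := fun y : Space n => (y, p.2)) p.1 h1
    (hasFDerivAt_prodMk_left p.1 p.2)
  have h3 : fderiv ℝ (fun y => u (y, p.2)) p.1 = _ := h2.fderiv
  rw [spaceGrad, gradient, h3]

theorem inner_spaceGrad (hu : ContDiff ℝ ∞ u) (p : Space n × ℝ) (ξ : Space n) :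
    inner ℝ (spaceGrad u p) ξ = fderiv ℝ u p (ξ, 0) := by
  rw [spaceGrad_eq hu, InnerProductSpace.toDual_symm_apply]
  rfl

theorem timeDeriv_eq (hu : ContDiff ℝ ∞ u) (p : Space n × ℝ) :
    timeDeriv u p = fderiv ℝ u p (0, 1) := by
  have h1 : HasFDerivAt u (fderiv ℝ u p) (p.1, p.2) :=
    (hu.differentiable (by simp) p).hasFDerivAt
  have h2 := HasFDerivAt.comp (f := fun y : ℝ => (p.1, y)) p.2 h1
    (hasFDerivAt_prodMk_right p.1 p.2)
  have h3 := h2.hasDerivAt.deriv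
  exact h3

theorem contDiff_spaceGrad (hu : ContDiff ℝ ∞ u) : ContDiff ℝ ∞ (spaceGrad u) := by
  have h : spaceGrad u = fun p => (InnerProductSpace.toDual ℝ (Space n)).symm
      ((fderiv ℝ u p).comp (ContinuousLinearMap.inl ℝ (Space n) ℝ)) := funext (spaceGrad_eq hu)
  rw [h]
  have h1 : ContDiff ℝ ∞ (fderiv ℝ u) := hu.fderiv_right (by simp)
  exact (InnerProductSpace.toDual ℝ (Space n)).symm.contDiff.comp (h1.clm_comp contDiff_const)

theorem contDiff_timeDeriv (hu : ContDiff ℝ ∞ u) : ContDiff ℝ ∞ (timeDeriv u) := by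
  have h : timeDeriv u = fun p => fderiv ℝ u p (0, 1) := funext (timeDeriv_eq hu)
  rw [h]
  have h1 : ContDiff ℝ ∞ (fderiv ℝ u) := hu.fderiv_right (by simp)
  exact h1.clm_apply contDiff_const

theorem derivativeAt_of_smooth (hu : ContDiff ℝ ∞ u) (p : Space n × ℝ) :
    DerivativeAt u p (fun w => inner ℝ (spaceGrad u p) w.1 + w.2 * timeDeriv u p) := by
  refine (DerivativeAt.of_differentiableAt (hu.differentiable (by simp) p)).congr_deriv
    fun w => ?_
  rw [inner_spaceGrad hu, timeDeriv_eq hu, ← smul_eq_mul, ← map_smul, ← map_add]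
  simp

theorem inner_fderiv_spaceGrad (hu : ContDiff ℝ ∞ u) (p w : Space n × ℝ) (η : Space n) :
    inner ℝ (fderiv ℝ (spaceGrad u) p w) η = fderiv ℝ (fderiv ℝ u) p w (η, 0) := by
  have h1 : DifferentiableAt ℝ (fderiv ℝ u) p :=
    (hu.fderiv_right (m := ∞) (by simp)).differentiable (by simp) p
  have h2 := (DerivativeAt.of_differentiableAt
    ((contDiff_spaceGrad hu).differentiable (by simp) p)).inner (DerivativeAt.const η)
  have h3 := (DerivativeAt.of_differentiableAt h1).clm_apply
    (DerivativeAt.const ((η, 0) : Space n × ℝ))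
  have h4 : (fun x => inner ℝ (spaceGrad u x) η) = fun x => fderiv ℝ u x (η, 0) :=
    funext fun x => inner_spaceGrad hu x η
  have h5 := h2.fderiv_apply w
  rw [h4, h3.fderiv_apply] at h5
  simpa using h5.symm

theorem fderiv_fderiv_symm (hu : ContDiff ℝ ∞ u) (p w w' : Space n × ℝ) :
    fderiv ℝ (fderiv ℝ u) p w w' = fderiv ℝ (fderiv ℝ u) p w' w :=
  (hu.contDiffAt.isSymmSndFDerivAt
    (by rw [minSmoothness_of_isRCLikeNormedField]; exact WithTop.coe_le_coe.2 le_top)) w w'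

theorem inner_fderiv_spaceGrad_symm (hu : ContDiff ℝ ∞ u) (p : Space n × ℝ) (ξ η : Space n) :
    inner ℝ (fderiv ℝ (spaceGrad u) p (ξ, 0)) η
      = inner ℝ (fderiv ℝ (spaceGrad u) p (η, 0)) ξ := by
  rw [inner_fderiv_spaceGrad hu, inner_fderiv_spaceGrad hu, fderiv_fderiv_symm hu]

theorem fderiv_timeDeriv (hu : ContDiff ℝ ∞ u) (p : Space n × ℝ) (ξ : Space n) :
    fderiv ℝ (timeDeriv u) p (ξ, 0) = inner ℝ (fderiv ℝ (spaceGrad u) p (0, 1)) ξ := by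
  have h1 : DifferentiableAt ℝ (fderiv ℝ u) p :=
    (hu.fderiv_right (m := ∞) (by simp)).differentiable (by simp) p
  have h3 := (DerivativeAt.of_differentiableAt h1).clm_apply
    (DerivativeAt.const ((0, 1) : Space n × ℝ))
  have h4 : timeDeriv u = fun x => fderiv ℝ u x (0, 1) := funext (timeDeriv_eq hu)
  rw [inner_fderiv_spaceGrad hu, fderiv_fderiv_symm hu, h4, h3.fderiv_apply]
  simp

end Smooth

/-! ### The weight, the radial field and the conjugated function -/

section Fields

variable (A : Space n × ℝ → Space n →L[ℝ] Space n) (G : ℝ → Space n →L[ℝ] Space n) (β : ℝ)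
  (u : Space n × ℝ → ℝ)

/-- The squared distance `σ² = ⟨G(t)x, x⟩`. -/
def quadDist (p : Space n × ℝ) : ℝ := inner ℝ (G p.2 p.1) p.1

/-- The logarithm `log σ` of the distance. -/
def logDist (p : Space n × ℝ) : ℝ := (1 / 2) * Real.log (quadDist G p)

/-- The vector field `A(x,t) G(t) x = σ² A ∇ log σ`, a perturbation of the Euler field `x`. -/
def radialField (p : Space n × ℝ) : Space n := A p (G p.2 p.1)

/-- The function `⟨A ∇σ, ∇σ⟩`, a perturbation of the constant `1`. -/
def eikonal (p : Space n × ℝ) : ℝ :=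
  Real.exp (-2 * logDist G p) * inner ℝ (radialField A G p) (G p.2 p.1)

/-- The conjugating factor `e^{β (log σ)² / 2}`. -/
def conjFactor (p : Space n × ℝ) : ℝ := Real.exp ((β / 2) * (logDist G p * logDist G p))

/-- The conjugated function `v = e^{β (log σ)² / 2} u`. -/
def conjFun (p : Space n × ℝ) : ℝ := conjFactor G β p * u p

/-- The space gradient of `conjFun`, in closed form. -/
def conjGrad (p : Space n × ℝ) : Space n :=
  conjFactor G β p • spaceGrad u p +
    (β * (logDist G p * Real.exp (-2 * logDist G p) * conjFun G β u p)) • G p.2 p.1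

/-- The conjugate `e^{β (log σ)² / 2} ∂ₜu` of the time derivative. Unlike the time derivative of
`conjFun` it does not involve the derivative of `G`, hence stays Lipschitz. -/
def conjTime (p : Space n × ℝ) : ℝ := conjFactor G β p * timeDeriv u p

variable {A G β u}

theorem exp_logDist {p : Space n × ℝ} (h : 0 < quadDist G p) :
    Real.exp (2 * logDist G p) = quadDist G p := by
  rw [logDist, ← mul_assoc]
  norm_num [Real.exp_log h]

/-- `A` and `G` are differentiable at `p`, with derivatives `A'` and `G'`, their values there are
symmetric, and `σ > 0`. -/
structure RegularAt (A : Space n × ℝ → Space n →L[ℝ] Space n) (G : ℝ → Space n →L[ℝ] Space n)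
    (p : Space n × ℝ) (A' : Space n × ℝ → Space n →L[ℝ] Space n) (G' : Space n →L[ℝ] Space n) :
    Prop where
  derivA : DerivativeAt A p A'
  derivG : DerivativeAt (fun x : Space n × ℝ => G x.2) p (fun w => w.2 • G')
  symmA : ∀ ξ η, inner ℝ (A p ξ) η = inner ℝ (A p η) ξ
  symmG : ∀ ξ η, inner ℝ (G p.2 ξ) η = inner ℝ (G p.2 η) ξ
  quad_pos : 0 < quadDist G p

/-- The time derivative of `log σ`. -/
def logDistTime (G : ℝ → Space n →L[ℝ] Space n) (G' : Space n →L[ℝ] Space n)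
    (p : Space n × ℝ) : ℝ :=
  Real.exp (-2 * logDist G p) * ((1 / 2) * inner ℝ (G' p.1) p.1)

/-- The time derivative of the factor `β (log σ) σ⁻² G x` in the gradient of the weight. -/
def weightGradTime (G : ℝ → Space n →L[ℝ] Space n) (G' : Space n →L[ℝ] Space n) (β : ℝ)
    (p : Space n × ℝ) : Space n :=
  (β * ((1 - 2 * logDist G p) * logDistTime G G' p * Real.exp (-2 * logDist G p))) • G p.2 p.1
    + (β * (logDist G p * Real.exp (-2 * logDist G p))) • G' p.1

namespace RegularAt

variable {p : Space n × ℝ} {A' : Space n × ℝ → Space n →L[ℝ] Space n}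
  {G' : Space n →L[ℝ] Space n}

theorem deriv_Gx (h : RegularAt A G p A' G') :
    DerivativeAt (fun x : Space n × ℝ => G x.2 x.1) p (fun w => w.2 • G' p.1 + G p.2 w.1) := by
  have h1 : DerivativeAt (fun x : Space n × ℝ => x.1) p (fun w => w.1) :=
    ⟨ContinuousLinearMap.fst ℝ _ _, hasFDerivAt_fst, fun _ => rfl⟩
  exact h.derivG.clm_apply h1

theorem deriv_logDist (h : RegularAt A G p A' G') :
    DerivativeAt (logDist G) p (fun w => Real.exp (-2 * logDist G p) * inner ℝ (G p.2 p.1) w.1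
      + w.2 * logDistTime G G' p) := by
  have h1 : DerivativeAt (fun x : Space n × ℝ => x.1) p (fun w => w.1) :=
    ⟨ContinuousLinearMap.fst ℝ _ _, hasFDerivAt_fst, fun _ => rfl⟩
  have h2 : DerivativeAt (quadDist G) p _ := h.deriv_Gx.inner h1
  refine ((h2.log h.quad_pos.ne').const_mul (1 / 2)).congr_deriv fun w => ?_
  have h3 : (quadDist G p)⁻¹ = Real.exp (-2 * logDist G p) := by
    rw [← exp_logDist h.quad_pos, ← Real.exp_neg]; congr 1; ring
  rw [h3, logDistTime, inner_add_left, inner_smul_left, h.symmG w.1]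
  simp only [conj_trivial]
  ring

theorem deriv_radialField (h : RegularAt A G p A' G') :
    DerivativeAt (radialField A G) p
      (fun w => A' w (G p.2 p.1) + A p (w.2 • G' p.1 + G p.2 w.1)) :=
  h.derivA.clm_apply h.deriv_Gx

theorem deriv_conjFactor (h : RegularAt A G p A' G') :
    DerivativeAt (conjFactor G β) p (fun w => conjFactor G β p * (β * logDist G p *
      (Real.exp (-2 * logDist G p) * inner ℝ (G p.2 p.1) w.1 + w.2 * logDistTime G G' p))) :=
  ((h.deriv_logDist.mul h.deriv_logDist).const_mul (β / 2)).exp.congr_deriv fun w => by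
    rw [conjFactor]; ring

theorem deriv_eikonal (h : RegularAt A G p A' G') :
    DerivativeAt (eikonal A G) p (fun w => Real.exp (-2 * logDist G p) *
      (inner ℝ (A' w (G p.2 p.1) + A p (w.2 • G' p.1 + G p.2 w.1)) (G p.2 p.1)
        + inner ℝ (radialField A G p) (w.2 • G' p.1 + G p.2 w.1))
      - 2 * (Real.exp (-2 * logDist G p) * inner ℝ (G p.2 p.1) w.1 + w.2 * logDistTime G G' p)
        * eikonal A G p) :=
  ((h.deriv_logDist.const_mul (-2)).exp.mul
    (h.deriv_radialField.inner h.deriv_Gx)).congr_deriv fun w => by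
      rw [eikonal]; ring

theorem deriv_conjFun (h : RegularAt A G p A' G') (hu : ContDiff ℝ ∞ u) :
    DerivativeAt (conjFun G β u) p (fun w => inner ℝ (conjGrad G β u p) w.1
      + w.2 * (conjTime G β u p + β * logDist G p * logDistTime G G' p * conjFun G β u p)) :=
  (h.deriv_conjFactor.mul (derivativeAt_of_smooth hu p)).congr_deriv fun w => by
    rw [conjGrad, conjTime, conjFun, inner_add_left, inner_smul_left, inner_smul_left]
    simp only [conj_trivial]
    ring

theorem deriv_conjTime (h : RegularAt A G p A' G') (hu : ContDiff ℝ ∞ u) :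
    DerivativeAt (conjTime G β u) p (fun w => conjFactor G β p * (β * logDist G p *
      (Real.exp (-2 * logDist G p) * inner ℝ (G p.2 p.1) w.1 + w.2 * logDistTime G G' p))
        * timeDeriv u p + conjFactor G β p * fderiv ℝ (timeDeriv u) p w) :=
  h.deriv_conjFactor.mul (DerivativeAt.of_differentiableAt
    ((contDiff_timeDeriv hu).differentiable (by simp) p))

theorem deriv_conjGrad (h : RegularAt A G p A' G') (hu : ContDiff ℝ ∞ u) :
    DerivativeAt (conjGrad G β u) p (fun w =>
      (conjFactor G β p * (β * logDist G p * (Real.exp (-2 * logDist G p)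
        * inner ℝ (G p.2 p.1) w.1 + w.2 * logDistTime G G' p))) • spaceGrad u p
      + conjFactor G β p • fderiv ℝ (spaceGrad u) p w
      + ((β * ((1 - 2 * logDist G p) * Real.exp (-2 * logDist G p)
            * (Real.exp (-2 * logDist G p) * inner ℝ (G p.2 p.1) w.1
              + w.2 * logDistTime G G' p) * conjFun G β u p
          + logDist G p * Real.exp (-2 * logDist G p) * (inner ℝ (conjGrad G β u p) w.1
            + w.2 * (conjTime G β u p
              + β * logDist G p * logDistTime G G' p * conjFun G β u p)))) • G p.2 p.1
        + (β * (logDist G p * Real.exp (-2 * logDist G p) * conjFun G β u p)) •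
          (w.2 • G' p.1 + G p.2 w.1))) :=
  ((h.deriv_conjFactor.smul (DerivativeAt.of_differentiableAt
    ((contDiff_spaceGrad hu).differentiable (by simp) p))).add
    ((((h.deriv_logDist.mul (h.deriv_logDist.const_mul (-2)).exp).mul
      (h.deriv_conjFun hu)).const_mul β).smul h.deriv_Gx)).congr_deriv fun w => by
    congr 4
    ring

theorem inner_Gx_A_apply (h : RegularAt A G p A' G') (z : Space n) :
    inner ℝ (G p.2 p.1) (A p z) = inner ℝ (radialField A G p) z := by
  rw [radialField, h.symmA, real_inner_comm]

end RegularAt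

/-! ### The pointwise identities -/

variable (A G β u)

/-- The field `σ^{2-n} A ∇v`. -/
def weightedFlux (x : Space n × ℝ) : Space n :=
  (Real.exp (-n * logDist G x) * Real.exp (2 * logDist G x)) • A x (conjGrad G β u x)

/-- The leading antisymmetric part of the conjugated operator applied to `v`; its time derivative is
that of `u`, see `conjTime`. -/
def antisymmPart (x : Space n × ℝ) : ℝ :=
  -2 * β * logDist G x * inner ℝ (radialField A G x) (conjGrad G β u x)
    - Real.exp (2 * logDist G x) * conjTime G β u x

/-- The leading symmetric part, with respect to `σ⁻ⁿ dx dt`, of the conjugated operator applied to `v`. -/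
def symmPart (x : Space n × ℝ) : ℝ :=
  Real.exp (n * logDist G x) * divergence (weightedFlux A G β u) x
    + β ^ 2 * logDist G x ^ 2 * eikonal A G x * conjFun G β u x

/-- The spatial component of the space-time field whose divergence carries the estimate. -/
def carlemanField (x : Space n × ℝ) : Space n :=
  ((-2 * β) * logDist G x * inner ℝ (radialField A G x) (conjGrad G β u x)
      - Real.exp (2 * logDist G x) * conjTime G β u x - 2 * β * conjFun G β u x) •
      ((Real.exp (-n * logDist G x) * Real.exp (2 * logDist G x)) • A x (conjGrad G β u x))
    - (-β * (logDist G x * (Real.exp (-n * logDist G x) * Real.exp (2 * logDist G x))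
          * inner ℝ (A x (conjGrad G β u x)) (conjGrad G β u x))
        + β ^ 3 * (Real.exp (-n * logDist G x) * (logDist G x * logDist G x * logDist G x
          * (eikonal A G x * (conjFun G β u x * conjFun G β u x))))) • radialField A G x

/-- The time component of the space-time field whose divergence carries the estimate. -/
def carlemanTime (x : Space n × ℝ) : ℝ :=
  (1 / 2) * (Real.exp (-n * logDist G x) * Real.exp (4 * logDist G x)
      * inner ℝ (A x (conjGrad G β u x)) (conjGrad G β u x))
    - (β ^ 2 / 2) * (Real.exp (-n * logDist G x) * Real.exp (2 * logDist G x)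
      * (logDist G x * logDist G x)
      * (eikonal A G x * (conjFun G β u x * conjFun G β u x)))

/-- The terms of the divergence identity that vanish for constant coefficients. -/
def carlemanError (A' : Space n × ℝ → Space n →L[ℝ] Space n) (G' : Space n →L[ℝ] Space n)
    (p : Space n × ℝ) : ℝ :=
  -2 * β * logDist G p * Real.exp (2 * logDist G p) *
      (inner ℝ (A' (A p (conjGrad G β u p), 0) (G p.2 p.1)
          + A p (G p.2 (A p (conjGrad G β u p)))) (conjGrad G β u p)
        - (1 / 2) * inner ℝ (A p (conjGrad G β u p)) (conjGrad G β u p)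
          * divergence (radialField A G) p
        - (1 / 2) * (2 - n) * eikonal A G p
          * inner ℝ (A p (conjGrad G β u p)) (conjGrad G β u p)
        - (1 / 2) * inner ℝ (A' (radialField A G p, 0) (conjGrad G β u p)) (conjGrad G β u p))
    + Real.exp (2 * logDist G p) ^ 2 *
      (β * logDist G p * logDistTime G G' p
          * inner ℝ (A p (conjGrad G β u p)) (conjGrad G β u p)
        + conjFun G β u p * inner ℝ (A p (conjGrad G β u p)) (weightGradTime G G' β p)
        + (1 / 2) * (4 - n) * logDistTime G G' p
          * inner ℝ (A p (conjGrad G β u p)) (conjGrad G β u p)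
        + (1 / 2) * inner ℝ (A' (0, 1) (conjGrad G β u p)) (conjGrad G β u p))
    - β ^ 3 * logDist G p ^ 3 * conjFun G β u p ^ 2 *
      (eikonal A G p * divergence (radialField A G) p - n * eikonal A G p ^ 2
        + fderiv ℝ (eikonal A G) p (radialField A G p, 0))
    - (1 / 2) * β ^ 2 * Real.exp (2 * logDist G p) * conjFun G β u p ^ 2 *
      ((2 - n) * logDistTime G G' p * logDist G p ^ 2 * eikonal A G p
        + 2 * logDist G p * logDistTime G G' p * eikonal A G p
        + logDist G p ^ 2 * fderiv ℝ (eikonal A G) p (0, 1)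
        + 2 * β * logDist G p ^ 3 * logDistTime G G' p * eikonal A G p)

variable {A G β u} {p : Space n × ℝ} {A' : Space n × ℝ → Space n →L[ℝ] Space n}
  {G' : Space n →L[ℝ] Space n}

/-- `divergence_identity` for the fields of the estimate. -/
theorem divergence_carlemanField (h : RegularAt A G p A' G') (hu : ContDiff ℝ ∞ u) :
    divergence (carlemanField A G β u) p + fderiv ℝ (carlemanTime A G β u) p (0, 1)
    = Real.exp (-n * logDist G p) * (
        (antisymmPart A G β u p - 2 * β * conjFun G β u p) * symmPart A G β u p
        + 2 * inner ℝ (radialField A G p) (conjGrad G β u p) * antisymmPart A G β u p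
        - (-4 * β * logDist G p + 2 * β)
          * inner ℝ (radialField A G p) (conjGrad G β u p) ^ 2
        - β * (2 - eikonal A G p) * Real.exp (2 * logDist G p)
          * inner ℝ (A p (conjGrad G β u p)) (conjGrad G β u p)
        - β ^ 3 * logDist G p ^ 2 * (3 * eikonal A G p ^ 2 - 2 * eikonal A G p)
          * conjFun G β u p ^ 2
        + carlemanError A G β u A' G' p) := by
  have key := divergence_identity (p := p) β (weightGradTime G G' β p) h.derivA h.deriv_logDist
    (DerivativeAt.of_differentiableAt (h.deriv_eikonal (A := A)).differentiableAt)
    (h.deriv_conjFun (β := β) hu) (h.deriv_conjTime (β := β) hu) h.deriv_radialField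
    (h.deriv_conjGrad (β := β) hu) h.symmA ?_ ?_ ?_ ?_ ?_ ?_
  · unfold carlemanField carlemanTime symmPart antisymmPart weightedFlux carlemanError
    rw [key]
    simp
  · intro ξ η
    have e1 : inner ℝ (G p.2 ξ) η = inner ℝ (G p.2 η) ξ := h.symmG ξ η
    have e2 := inner_fderiv_spaceGrad_symm hu p ξ η
    simp only [inner_add_left, inner_smul_left, conj_trivial, zero_smul, zero_mul, add_zero,
      zero_add, e1, e2, conjGrad]
    ring
  · simp [h.inner_Gx_A_apply]
  · simp [eikonal, real_inner_comm]
  · intro ξ; simp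
  · simp
  · intro ξ
    simp only [inner_add_left, inner_smul_left, conj_trivial, one_smul, one_mul, mul_zero, zero_mul,
      add_zero, zero_add, map_zero, inner_zero_right, conjGrad, weightGradTime,
      fderiv_timeDeriv hu, conjTime]
    ring

/-- The decomposition of `σ² e^{β s² / 2} (ℒ - ∂ₜ) u` into `S + B` and lower-order terms. -/
theorem conjugated_operator (h : RegularAt A G p A' G') (hu : ContDiff ℝ ∞ u) :
    Real.exp (2 * logDist G p) * conjFactor G β p *
      (divergence (fun x => A x (spaceGrad u x)) p - timeDeriv u p)
    = symmPart A G β u p + antisymmPart A G β u p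
      + (n - 2) * inner ℝ (radialField A G p) (conjGrad G β u p)
      - β * eikonal A G p * conjFun G β u p
      - β * logDist G p * (divergence (radialField A G) p - 2 * eikonal A G p)
        * conjFun G β u p := by
  have hAg := h.derivA.clm_apply (h.deriv_conjGrad (β := β) hu)
  have he1 : DerivativeAt (fun x => Real.exp (-n * logDist G x)) p _ :=
    (h.deriv_logDist.const_mul (-(n : ℝ))).exp
  have he2 : DerivativeAt (fun x => Real.exp (2 * logDist G x)) p _ :=
    (h.deriv_logDist.const_mul 2).exp
  have hW : DerivativeAt (weightedFlux A G β u) p _ := (he1.mul he2).smul hAg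
  have hc1 := ((h.deriv_logDist.mul h.deriv_logDist).const_mul (-(β / 2))).exp.mul
    ((h.deriv_logDist.const_mul (n : ℝ)).exp.mul (h.deriv_logDist.const_mul (-2)).exp)
  have hc2 := ((h.deriv_logDist.mul (h.deriv_logDist.const_mul (-2)).exp).mul
    (derivativeAt_of_smooth hu p)).const_mul β
  have hexp : ∀ x, Real.exp (-(β / 2) * (logDist G x * logDist G x)) * conjFactor G β x = 1 :=
    fun x => by rw [conjFactor, ← Real.exp_add]; simp
  have hn : ∀ x, Real.exp (n * logDist G x) * Real.exp (-n * logDist G x) = 1 := fun x => by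
    rw [← Real.exp_add]; simp
  have h2 : ∀ x, Real.exp (-2 * logDist G x) * Real.exp (2 * logDist G x) = 1 := fun x => by
    rw [← Real.exp_add]; simp
  -- The flux `A∇u` in terms of `∇v` and `v`.
  have hflux : (fun x => A x (spaceGrad u x)) = fun x =>
      (Real.exp (-(β / 2) * (logDist G x * logDist G x)) * (Real.exp (n * logDist G x)
        * Real.exp (-2 * logDist G x))) • weightedFlux A G β u x
      - (β * (logDist G x * Real.exp (-2 * logDist G x) * u x)) • radialField A G x := by
    funext x
    rw [weightedFlux, conjGrad, radialField, smul_smul, map_add, map_smul, map_smul, smul_add,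
      smul_smul, smul_smul]
    have e1 : Real.exp (-(β / 2) * (logDist G x * logDist G x)) * (Real.exp (n * logDist G x)
        * Real.exp (-2 * logDist G x)) * (Real.exp (-n * logDist G x)
        * Real.exp (2 * logDist G x)) = Real.exp (-(β / 2) * (logDist G x * logDist G x)) := by
      linear_combination (Real.exp (-(β / 2) * (logDist G x * logDist G x))
        * Real.exp (-2 * logDist G x) * Real.exp (2 * logDist G x)) * hn x
        + Real.exp (-(β / 2) * (logDist G x * logDist G x)) * h2 x
    rw [e1, hexp, one_smul, conjFun, add_sub_assoc, ← sub_smul]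
    have e2 : Real.exp (-(β / 2) * (logDist G x * logDist G x)) * (β * (logDist G x
        * Real.exp (-2 * logDist G x) * (conjFactor G β x * u x)))
        - β * (logDist G x * Real.exp (-2 * logDist G x) * u x) = 0 := by
      linear_combination (β * (logDist G x * Real.exp (-2 * logDist G x) * u x)) * hexp x
    rw [e2, zero_smul, add_zero]
  rw [hflux, divergence_sub (hc1.smul hW).differentiableAt
    (hc2.smul h.deriv_radialField).differentiableAt, divergence_smul hc1 hW.differentiableAt,
    divergence_smul hc2 h.deriv_radialField.differentiableAt]
  have hU : inner ℝ (conjGrad G β u p) (radialField A G p)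
      = conjFactor G β p * inner ℝ (spaceGrad u p) (radialField A G p)
        + β * logDist G p * conjFun G β u p * eikonal A G p := by
    rw [conjGrad, inner_add_left, inner_smul_left, inner_smul_left, eikonal,
      real_inner_comm (radialField A G p) (G p.2 p.1)]
    simp only [conj_trivial]
    ring
  have hG : inner ℝ (G p.2 p.1) (weightedFlux A G β u p) = Real.exp (-n * logDist G p)
      * Real.exp (2 * logDist G p) * inner ℝ (conjGrad G β u p) (radialField A G p) := by
    rw [weightedFlux, inner_smul_right, h.inner_Gx_A_apply, real_inner_comm]
  have hq : Real.exp (-2 * logDist G p) * inner ℝ (G p.2 p.1) (radialField A G p)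
      = eikonal A G p := by rw [eikonal, real_inner_comm]
  simp only [zero_mul, add_zero, hG, hq]
  rw [symmPart, antisymmPart, conjTime, real_inner_comm (conjGrad G β u p)]
  have hx := hexp p
  have hnp := hn p
  have h2p := h2 p
  have hv : conjFun G β u p = conjFactor G β p * u p := rfl
  generalize divergence (weightedFlux A G β u) p = δW
  generalize divergence (radialField A G) p = δY
  generalize Real.exp (-(β / 2) * (logDist G p * logDist G p)) = φi at *
  generalize Real.exp (n * logDist G p) = en at *
  generalize Real.exp (-n * logDist G p) = μ at *
  generalize Real.exp (2 * logDist G p) = a at *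
  generalize Real.exp (-2 * logDist G p) = ai at *
  generalize inner ℝ (conjGrad G β u p) (radialField A G p) = y at *
  generalize inner ℝ (spaceGrad u p) (radialField A G p) = yu at *
  generalize conjFactor G β p = φ at *
  generalize conjFun G β u p = v at *
  generalize logDist G p = s at *
  generalize eikonal A G p = q at *
  have ha : a ≠ 0 := right_ne_zero_of_mul_eq_one h2p
  have hφ : φ ≠ 0 := right_ne_zero_of_mul_eq_one hx
  have hμ : μ ≠ 0 := right_ne_zero_of_mul_eq_one hnp
  rw [eq_inv_of_mul_eq_one_left h2p, eq_inv_of_mul_eq_one_left hx,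
    eq_inv_of_mul_eq_one_left hnp, hU, hv]
  field_simp
  ring

end Fields

/-! ### Bounds for the coefficients near the origin -/

/-- Quantitative bounds, with one constant `M`, on the coefficients and their derivatives at a point
`p = (x,t)`. The field `near_inv` says that `A(x,t)` and `G(t)⁻¹ = A(0,t)` differ by `O(|x|)`. -/
structure BoundedAt (M : ℝ) (A : Space n × ℝ → Space n →L[ℝ] Space n)
    (G : ℝ → Space n →L[ℝ] Space n) (p : Space n × ℝ)
    (A' : Space n × ℝ → Space n →L[ℝ] Space n) (G' : Space n →L[ℝ] Space n) : Prop where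
  one_le : 1 ≤ M
  norm_A : ∀ ξ, ‖A p ξ‖ ≤ M * ‖ξ‖
  norm_G : ∀ ξ, ‖G p.2 ξ‖ ≤ M * ‖ξ‖
  coercive_A : ∀ ξ, ‖ξ‖ ^ 2 ≤ M * inner ℝ (A p ξ) ξ
  coercive_G : ∀ ξ, ‖ξ‖ ^ 2 ≤ M * inner ℝ (G p.2 ξ) ξ
  near_inv : ∀ ξ, ‖A p (G p.2 ξ) - ξ‖ ≤ M * ‖p.1‖ * ‖ξ‖
  norm_A'_space : ∀ ζ ξ, ‖A' (ζ, 0) ξ‖ ≤ M * ‖ζ‖ * ‖ξ‖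
  norm_A'_time : ∀ ξ, ‖A' (0, 1) ξ‖ ≤ M * ‖ξ‖
  norm_G' : ∀ ξ, ‖G' ξ‖ ≤ M * ‖ξ‖

theorem abs_inner_le_of_le {E : Type*} [NormedAddCommGroup E] [InnerProductSpace ℝ E] {x y : E}
    {a b : ℝ} (hx : ‖x‖ ≤ a) (hy : ‖y‖ ≤ b) : |inner ℝ x y| ≤ a * b :=
  (abs_real_inner_le_norm x y).trans
    (mul_le_mul hx hy (norm_nonneg _) ((norm_nonneg _).trans hx))

namespace BoundedAt

variable {M β : ℝ} {A : Space n × ℝ → Space n →L[ℝ] Space n} {G : ℝ → Space n →L[ℝ] Space n}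
  {u : Space n × ℝ → ℝ}
  {p : Space n × ℝ} {A' : Space n × ℝ → Space n →L[ℝ] Space n} {G' : Space n →L[ℝ] Space n}

theorem pos (hb : BoundedAt M A G p A' G') : 0 < M := one_pos.trans_le hb.one_le

theorem quadDist_le (hb : BoundedAt M A G p A' G') : quadDist G p ≤ M * ‖p.1‖ ^ 2 := by
  have := abs_inner_le_of_le (hb.norm_G p.1) le_rfl (y := p.1)
  have := le_abs_self (inner ℝ (G p.2 p.1) p.1)
  rw [quadDist]
  nlinarith

theorem exp_neg_le (hb : BoundedAt M A G p A' G') (hq : 0 < quadDist G p) :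
    Real.exp (-2 * logDist G p) * ‖p.1‖ ^ 2 ≤ M := by
  have h1 := hb.coercive_G p.1
  have h2 : Real.exp (-2 * logDist G p) * quadDist G p = 1 := by
    rw [← exp_logDist hq, ← Real.exp_add]; simp
  have h3 := (Real.exp_pos (-2 * logDist G p)).le
  calc Real.exp (-2 * logDist G p) * ‖p.1‖ ^ 2
      ≤ Real.exp (-2 * logDist G p) * (M * quadDist G p) := by gcongr; exact h1
    _ = M := by linear_combination M * h2

theorem exp_le (hb : BoundedAt M A G p A' G') (hq : 0 < quadDist G p) :
    Real.exp (2 * logDist G p) ≤ M * ‖p.1‖ ^ 2 := by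
  rw [exp_logDist hq]; exact hb.quadDist_le

theorem abs_logDistTime_le (hb : BoundedAt M A G p A' G') (hq : 0 < quadDist G p) :
    |logDistTime G G' p| ≤ M ^ 2 := by
  have h1 := hb.exp_neg_le hq
  have h2 := abs_inner_le_of_le (hb.norm_G' p.1) le_rfl (y := p.1)
  have h3 := (Real.exp_pos (-2 * logDist G p)).le
  have h4 := hb.pos
  rw [logDistTime, abs_mul, abs_mul, abs_of_nonneg h3]
  calc _ ≤ Real.exp (-2 * logDist G p) * (|1 / 2| * (M * ‖p.1‖ * ‖p.1‖)) := by gcongr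
    _ = M * (Real.exp (-2 * logDist G p) * ‖p.1‖ ^ 2) / 2 := by
      rw [abs_of_pos (by norm_num)]; ring
    _ ≤ M * M / 2 := by gcongr
    _ ≤ M ^ 2 := by nlinarith

theorem norm_radialField_sub (hb : BoundedAt M A G p A' G') :
    ‖radialField A G p - p.1‖ ≤ M * ‖p.1‖ ^ 2 :=
  (hb.near_inv p.1).trans_eq (by ring)

theorem norm_radialField (hb : BoundedAt M A G p A' G') :
    ‖radialField A G p‖ ≤ M ^ 2 * ‖p.1‖ := by
  have h4 := hb.pos
  calc ‖radialField A G p‖ ≤ M * ‖G p.2 p.1‖ := hb.norm_A _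
    _ ≤ M * (M * ‖p.1‖) := by gcongr; exact hb.norm_G _
    _ = M ^ 2 * ‖p.1‖ := by ring

theorem abs_eikonal_sub_one (hb : BoundedAt M A G p A' G') (hq : 0 < quadDist G p) :
    |eikonal A G p - 1| ≤ M ^ 3 * ‖p.1‖ := by
  have h1 := hb.exp_neg_le hq
  have h2 : Real.exp (-2 * logDist G p) * quadDist G p = 1 := by
    rw [← exp_logDist hq, ← Real.exp_add]; simp
  have h3 := (Real.exp_pos (-2 * logDist G p)).le
  have h4 := hb.pos
  have h5 : eikonal A G p - 1 = Real.exp (-2 * logDist G p) *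
      inner ℝ (radialField A G p - p.1) (G p.2 p.1) := by
    rw [inner_sub_left, mul_sub, eikonal, real_inner_comm (G p.2 p.1) p.1]
    rw [quadDist] at h2
    linarith
  rw [h5, abs_mul, abs_of_nonneg h3]
  calc _ ≤ Real.exp (-2 * logDist G p) * ((M * ‖p.1‖ ^ 2) * (M * ‖p.1‖)) := by
        gcongr; exact abs_inner_le_of_le hb.norm_radialField_sub (hb.norm_G _)
    _ = M ^ 2 * ‖p.1‖ * (Real.exp (-2 * logDist G p) * ‖p.1‖ ^ 2) := by ring
    _ ≤ M ^ 2 * ‖p.1‖ * M := by gcongr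
    _ = M ^ 3 * ‖p.1‖ := by ring

/-- The space derivative of the radial field is `I + O(|x|)`. -/
theorem norm_deriv_radialField_sub (hb : BoundedAt M A G p A' G') (ξ : Space n) :
    ‖A' (ξ, 0) (G p.2 p.1) + A p (G p.2 ξ) - ξ‖ ≤ 2 * M ^ 2 * ‖p.1‖ * ‖ξ‖ := by
  have h4 := hb.pos
  rw [add_sub_assoc]
  calc _ ≤ ‖A' (ξ, 0) (G p.2 p.1)‖ + ‖A p (G p.2 ξ) - ξ‖ := norm_add_le _ _
    _ ≤ M * ‖ξ‖ * (M * ‖p.1‖) + M * ‖p.1‖ * ‖ξ‖ := by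
      gcongr
      · exact (hb.norm_A'_space _ _).trans (by gcongr; exact hb.norm_G _)
      · exact hb.near_inv ξ
    _ = M * (M + 1) * (‖p.1‖ * ‖ξ‖) := by ring
    _ ≤ M * (M + M) * (‖p.1‖ * ‖ξ‖) := by gcongr; exact hb.one_le
    _ = _ := by ring

theorem abs_divergence_radialField_sub (hb : BoundedAt M A G p A' G')
    (h : RegularAt A G p A' G') :
    |divergence (radialField A G) p - n| ≤ 2 * n * M ^ 2 * ‖p.1‖ := by
  have h1 : divergence (radialField A G) p - n = ∑ i : Fin n,
      (A' (EuclideanSpace.single i 1, 0) (G p.2 p.1) + A p (G p.2 (EuclideanSpace.single i 1))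
        - EuclideanSpace.single i 1 : Space n) i := by
    simp [divergence, h.deriv_radialField.fderiv_apply, Finset.sum_sub_distrib,
      Finset.sum_add_distrib]
  rw [h1]
  calc _ ≤ ∑ i : Fin n, |(A' (EuclideanSpace.single i 1, 0) (G p.2 p.1)
        + A p (G p.2 (EuclideanSpace.single i 1)) - EuclideanSpace.single i 1 : Space n) i| :=
        Finset.abs_sum_le_sum_abs _ _
    _ ≤ ∑ i : Fin n, 2 * M ^ 2 * ‖p.1‖ := by
      gcongr with i
      refine (PiLp.norm_apply_le _ i).trans ((hb.norm_deriv_radialField_sub _).trans_eq ?_)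
      simp
    _ = _ := by simp; ring

theorem abs_deriv_eikonal_radial (hb : BoundedAt M A G p A' G') (h : RegularAt A G p A' G')
    (hq2 : |eikonal A G p| ≤ 2) :
    |fderiv ℝ (eikonal A G) p (radialField A G p, 0)| ≤ 7 * M ^ 6 * ‖p.1‖ := by
  have h1 := hb.exp_neg_le h.quad_pos
  have h3 := (Real.exp_pos (-2 * logDist G p)).le
  have h4 := hb.pos
  have hq1 := hb.abs_eikonal_sub_one h.quad_pos
  rw [h.deriv_eikonal.fderiv_apply]
  set Y := radialField A G p
  set E := A' (Y, 0) (G p.2 p.1) + A p (G p.2 Y) - Y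
  have hE : ‖E‖ ≤ 2 * M ^ 4 * ‖p.1‖ ^ 2 :=
    (hb.norm_deriv_radialField_sub Y).trans (by
      calc _ ≤ 2 * M ^ 2 * ‖p.1‖ * (M ^ 2 * ‖p.1‖) := by gcongr; exact hb.norm_radialField
        _ = _ := by ring)
  have hGY : ‖G p.2 (Y - p.1)‖ ≤ M * (M * ‖p.1‖ ^ 2) :=
    (hb.norm_G _).trans (by gcongr; exact hb.norm_radialField_sub)
  have e1 : Real.exp (-2 * logDist G p) * inner ℝ (G p.2 p.1) Y = eikonal A G p := by
    rw [eikonal, real_inner_comm]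
  have e2 : Real.exp (-2 * logDist G p) * inner ℝ Y (G p.2 p.1) = eikonal A G p := rfl
  have e3 : A' (Y, 0) (G p.2 p.1) + A p (G p.2 Y) = Y + E := by simp [E]
  have e4 : G p.2 Y = G p.2 p.1 + G p.2 (Y - p.1) := by rw [← map_add]; congr 1; abel
  simp only [zero_smul, zero_mul, add_zero, zero_add]
  rw [e3, e1, e4, inner_add_left, inner_add_right]
  have e5 : Real.exp (-2 * logDist G p) * (inner ℝ Y (G p.2 p.1) + inner ℝ E (G p.2 p.1)
      + (inner ℝ Y (G p.2 p.1) + inner ℝ Y (G p.2 (Y - p.1))))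
      - 2 * eikonal A G p * eikonal A G p
      = -(2 * eikonal A G p * (eikonal A G p - 1))
        + Real.exp (-2 * logDist G p) * (inner ℝ E (G p.2 p.1) + inner ℝ Y (G p.2 (Y - p.1))) := by
    linear_combination 2 * e2
  rw [e5]
  have b1 : |2 * eikonal A G p * (eikonal A G p - 1)| ≤ 4 * (M ^ 3 * ‖p.1‖) := by
    rw [abs_mul, abs_mul, abs_two]
    calc _ ≤ 2 * 2 * (M ^ 3 * ‖p.1‖) := by gcongr
      _ = _ := by ring
  have b2 : |inner ℝ E (G p.2 p.1) + inner ℝ Y (G p.2 (Y - p.1))|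
      ≤ 3 * M ^ 5 * ‖p.1‖ * ‖p.1‖ ^ 2 := by
    refine (abs_add_le _ _).trans ?_
    calc _ ≤ 2 * M ^ 4 * ‖p.1‖ ^ 2 * (M * ‖p.1‖) + M ^ 2 * ‖p.1‖ * (M * (M * ‖p.1‖ ^ 2)) :=
          add_le_add (abs_inner_le_of_le hE (hb.norm_G _))
            (abs_inner_le_of_le hb.norm_radialField hGY)
      _ = (2 * M ^ 5 + M ^ 4) * (‖p.1‖ * ‖p.1‖ ^ 2) := by ring
      _ ≤ (2 * M ^ 5 + M ^ 5) * (‖p.1‖ * ‖p.1‖ ^ 2) := by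
          gcongr
          · exact hb.one_le
          · norm_num
      _ = _ := by ring
  calc _ ≤ |2 * eikonal A G p * (eikonal A G p - 1)| + Real.exp (-2 * logDist G p)
        * |inner ℝ E (G p.2 p.1) + inner ℝ Y (G p.2 (Y - p.1))| := by
        refine (abs_add_le _ _).trans_eq ?_
        rw [abs_neg, abs_mul (Real.exp _), abs_of_nonneg h3]
    _ ≤ 4 * (M ^ 3 * ‖p.1‖) + Real.exp (-2 * logDist G p)
        * (3 * M ^ 5 * ‖p.1‖ * ‖p.1‖ ^ 2) := by gcongr
    _ = 4 * (M ^ 3 * ‖p.1‖) + 3 * M ^ 5 * ‖p.1‖ * (Real.exp (-2 * logDist G p) * ‖p.1‖ ^ 2) := by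
        ring
    _ ≤ 4 * (M ^ 6 * ‖p.1‖) + 3 * M ^ 5 * ‖p.1‖ * M := by
        gcongr
        · exact hb.one_le
        · norm_num
    _ = _ := by ring

theorem abs_deriv_eikonal_time (hb : BoundedAt M A G p A' G') (h : RegularAt A G p A' G')
    (hq2 : |eikonal A G p| ≤ 2) :
    |fderiv ℝ (eikonal A G) p (0, 1)| ≤ 7 * M ^ 4 := by
  have h1 := hb.exp_neg_le h.quad_pos
  have h3 := (Real.exp_pos (-2 * logDist G p)).le
  have h4 := hb.pos
  have hst := hb.abs_logDistTime_le h.quad_pos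
  rw [h.deriv_eikonal.fderiv_apply]
  simp only [one_smul, map_zero, add_zero, inner_zero_right, mul_zero, zero_add, one_mul]
  have b0 : ‖A' (0, 1) (G p.2 p.1) + A p (G' p.1)‖ ≤ 2 * M ^ 2 * ‖p.1‖ := by
    refine (norm_add_le _ _).trans ?_
    calc _ ≤ M * (M * ‖p.1‖) + M * (M * ‖p.1‖) := by
          gcongr
          · exact (hb.norm_A'_time _).trans (by gcongr; exact hb.norm_G _)
          · exact (hb.norm_A _).trans (by gcongr; exact hb.norm_G' _)
      _ = _ := by ring
  have b1 : |inner ℝ (A' (0, 1) (G p.2 p.1) + A p (G' p.1)) (G p.2 p.1)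
      + inner ℝ (radialField A G p) (G' p.1)| ≤ 3 * M ^ 3 * ‖p.1‖ ^ 2 := by
    refine (abs_add_le _ _).trans ?_
    calc _ ≤ 2 * M ^ 2 * ‖p.1‖ * (M * ‖p.1‖) + M ^ 2 * ‖p.1‖ * (M * ‖p.1‖) :=
          add_le_add (abs_inner_le_of_le b0 (hb.norm_G _))
            (abs_inner_le_of_le hb.norm_radialField (hb.norm_G' _))
      _ = _ := by ring
  refine (abs_sub _ _).trans ?_
  rw [abs_mul, abs_of_nonneg h3, abs_mul, abs_mul, abs_two]
  calc _ ≤ Real.exp (-2 * logDist G p) * (3 * M ^ 3 * ‖p.1‖ ^ 2) + 2 * M ^ 2 * 2 := by gcongr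
    _ = 3 * M ^ 3 * (Real.exp (-2 * logDist G p) * ‖p.1‖ ^ 2) + 4 * M ^ 2 := by ring
    _ ≤ 3 * M ^ 3 * M + 4 * M ^ 4 := by
        gcongr
        · exact hb.one_le
        · norm_num
    _ = _ := by ring

theorem norm_weightGradTime (hb : BoundedAt M A G p A' G') (hq : 0 < quadDist G p)
    (hβ : 0 ≤ β) (hs : 1 ≤ |logDist G p|) :
    ‖weightGradTime G G' β p‖ * ‖p.1‖ ≤ 4 * M ^ 4 * (β * |logDist G p|) := by
  have h1 := hb.exp_neg_le hq
  have h3 := (Real.exp_pos (-2 * logDist G p)).le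
  have h4 := hb.pos
  have hst := hb.abs_logDistTime_le hq
  have h12 : |1 - 2 * logDist G p| ≤ 3 * |logDist G p| := by
    refine (abs_sub _ _).trans ?_
    rw [abs_mul, abs_two, abs_one]; linarith
  have b : ‖weightGradTime G G' β p‖ ≤ β * (3 * |logDist G p| * M ^ 2
      * Real.exp (-2 * logDist G p)) * (M * ‖p.1‖)
      + β * (|logDist G p| * Real.exp (-2 * logDist G p)) * (M * ‖p.1‖) := by
    refine (norm_add_le _ _).trans ?_
    rw [norm_smul, norm_smul]
    simp only [Real.norm_eq_abs, abs_mul, abs_of_nonneg h3, abs_of_nonneg hβ]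
    gcongr
    · exact hb.norm_G _
    · exact hb.norm_G' _
  calc _ ≤ (β * (3 * |logDist G p| * M ^ 2 * Real.exp (-2 * logDist G p)) * (M * ‖p.1‖)
      + β * (|logDist G p| * Real.exp (-2 * logDist G p)) * (M * ‖p.1‖)) * ‖p.1‖ := by gcongr
    _ = (3 * M ^ 3 + M) * (β * |logDist G p|) * (Real.exp (-2 * logDist G p) * ‖p.1‖ ^ 2) := by
      ring
    _ ≤ (3 * M ^ 3 + M ^ 3) * (β * |logDist G p|) * M := by
      gcongr
      exact le_self_pow₀ hb.one_le (by norm_num)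
    _ = _ := by ring

end BoundedAt

/-! ### The error terms -/

namespace BoundedAt

variable {M β : ℝ} {A : Space n × ℝ → Space n →L[ℝ] Space n} {G : ℝ → Space n →L[ℝ] Space n}
  {u : Space n × ℝ → ℝ}
  {p : Space n × ℝ} {A' : Space n × ℝ → Space n →L[ℝ] Space n} {G' : Space n →L[ℝ] Space n}

theorem energy_nonneg (hb : BoundedAt M A G p A' G') (g : Space n) :
    0 ≤ inner ℝ (A p g) g := by
  have h1 := hb.coercive_A g
  have h2 := hb.pos
  by_contra h
  have : M * inner ℝ (A p g) g < 0 := mul_neg_of_pos_of_neg h2 (not_le.1 h)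
  nlinarith [sq_nonneg ‖g‖]

/-- The error produced by the spatial derivatives of the radial field and of `A`. -/
theorem abs_spatial_error_le (hb : BoundedAt M A G p A' G') (h : RegularAt A G p A' G')
    (g : Space n) :
    |inner ℝ (A' (A p g, 0) (G p.2 p.1) + A p (G p.2 (A p g))) g
        - (1 / 2) * inner ℝ (A p g) g * divergence (radialField A G) p
        - (1 / 2) * (2 - n) * eikonal A G p * inner ℝ (A p g) g
        - (1 / 2) * inner ℝ (A' (radialField A G p, 0) g) g|
      ≤ (4 + 2 * n) * M ^ 4 * ‖p.1‖ * inner ℝ (A p g) g := by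
  have hM := hb.one_le
  have h4 := hb.pos
  have hN := hb.energy_nonneg g
  have hg := hb.coercive_A g
  have hδ := hb.abs_divergence_radialField_sub h
  have hq := hb.abs_eikonal_sub_one h.quad_pos
  set N := inner ℝ (A p g) g with hNdef
  set δ := divergence (radialField A G) p
  set q := eikonal A G p
  have b1 : |inner ℝ (A' (A p g, 0) (G p.2 p.1) + A p (G p.2 (A p g)) - A p g) g|
      ≤ 2 * (M ^ 4 * ‖p.1‖ * N) := by
    calc _ ≤ 2 * M ^ 2 * ‖p.1‖ * (M * ‖g‖) * ‖g‖ := by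
          refine abs_inner_le_of_le ((hb.norm_deriv_radialField_sub _).trans ?_) le_rfl
          gcongr
          exact hb.norm_A _
      _ = 2 * M ^ 3 * ‖p.1‖ * ‖g‖ ^ 2 := by ring
      _ ≤ 2 * M ^ 3 * ‖p.1‖ * (M * N) := by gcongr
      _ = _ := by ring
  have b2 : |(1 / 2) * N * (δ - n)| ≤ n * (M ^ 4 * ‖p.1‖ * N) := by
    rw [abs_mul, abs_mul, abs_of_nonneg hN, abs_of_pos (by norm_num : (0 : ℝ) < 1 / 2)]
    calc _ ≤ 1 / 2 * N * (2 * n * M ^ 2 * ‖p.1‖) := by gcongr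
      _ = n * (M ^ 2 * ‖p.1‖ * N) := by ring
      _ ≤ _ := by gcongr; norm_num
  have b3 : |(1 / 2) * (2 - n) * (q - 1) * N| ≤ (n + 2) / 2 * (M ^ 4 * ‖p.1‖ * N) := by
    have hn : |(2 : ℝ) - n| ≤ n + 2 := by
      refine (abs_sub _ _).trans ?_
      rw [abs_two, Nat.abs_cast]; linarith
    rw [abs_mul, abs_mul, abs_mul, abs_of_nonneg hN, abs_of_pos (by norm_num : (0 : ℝ) < 1 / 2)]
    calc _ ≤ 1 / 2 * (n + 2) * (M ^ 3 * ‖p.1‖) * N := by gcongr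
      _ = (n + 2) / 2 * (M ^ 3 * ‖p.1‖ * N) := by ring
      _ ≤ _ := by gcongr; norm_num
  have b4 : |(1 / 2) * inner ℝ (A' (radialField A G p, 0) g) g|
      ≤ 1 / 2 * (M ^ 4 * ‖p.1‖ * N) := by
    rw [abs_mul, abs_of_pos (by norm_num : (0 : ℝ) < 1 / 2)]
    gcongr
    calc _ ≤ M * (M ^ 2 * ‖p.1‖) * ‖g‖ * ‖g‖ := by
          refine abs_inner_le_of_le ((hb.norm_A'_space _ _).trans ?_) le_rfl
          gcongr
          exact hb.norm_radialField
      _ = M ^ 3 * ‖p.1‖ * ‖g‖ ^ 2 := by ring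
      _ ≤ M ^ 3 * ‖p.1‖ * (M * N) := by gcongr
      _ = _ := by ring
  have e : inner ℝ (A' (A p g, 0) (G p.2 p.1) + A p (G p.2 (A p g))) g
        - (1 / 2) * N * δ - (1 / 2) * (2 - n) * q * N
        - (1 / 2) * inner ℝ (A' (radialField A G p, 0) g) g
      = inner ℝ (A' (A p g, 0) (G p.2 p.1) + A p (G p.2 (A p g)) - A p g) g
        - (1 / 2) * N * (δ - n) - (1 / 2) * (2 - n) * (q - 1) * N
        - (1 / 2) * inner ℝ (A' (radialField A G p, 0) g) g := by
    rw [inner_sub_left, ← hNdef]; ring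
  rw [e]
  have hX : 0 ≤ M ^ 4 * ‖p.1‖ * N := by positivity
  have hn0 : (0 : ℝ) ≤ n := Nat.cast_nonneg n
  have t : 2 * (M ^ 4 * ‖p.1‖ * N) + n * (M ^ 4 * ‖p.1‖ * N)
      + (n + 2) / 2 * (M ^ 4 * ‖p.1‖ * N) + 1 / 2 * (M ^ 4 * ‖p.1‖ * N)
      ≤ (4 + 2 * n) * M ^ 4 * ‖p.1‖ * N := by nlinarith [mul_nonneg hn0 hX]
  refine le_trans ?_ t
  refine (abs_sub _ _).trans (add_le_add ?_ b4)
  refine (abs_sub _ _).trans (add_le_add ?_ b3)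
  exact (abs_sub _ _).trans (add_le_add b1 b2)

/-- The error produced by the time derivatives in the terms that contain the gradient. -/
theorem abs_time_error_le (hb : BoundedAt M A G p A' G') (h : RegularAt A G p A' G')
    (hr : ‖p.1‖ ≤ 1) (hβ : 1 ≤ β) (hs : 1 ≤ |logDist G p|) (v : ℝ) (g : Space n) :
    |Real.exp (2 * logDist G p) ^ 2 *
      (β * logDist G p * logDistTime G G' p * inner ℝ (A p g) g
        + v * inner ℝ (A p g) (weightGradTime G G' β p)
        + (1 / 2) * (4 - n) * logDistTime G G' p * inner ℝ (A p g) g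
        + (1 / 2) * inner ℝ (A' (0, 1) g) g)|
      ≤ (n + 8) * M ^ 8 * (‖p.1‖ * |logDist G p|)
        * (β * (Real.exp (2 * logDist G p) * inner ℝ (A p g) g + v ^ 2)) := by
  have hM := hb.one_le
  have h4 := hb.pos
  have hN := hb.energy_nonneg g
  have hg := hb.coercive_A g
  have ha := hb.exp_le h.quad_pos
  have ha0 := (Real.exp_pos (2 * logDist G p)).le
  have hst := hb.abs_logDistTime_le h.quad_pos
  have hκ := hb.norm_weightGradTime h.quad_pos (by linarith : 0 ≤ β) hs
  have hn0 : (0 : ℝ) ≤ n := Nat.cast_nonneg n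
  set N := inner ℝ (A p g) g
  set a := Real.exp (2 * logDist G p)
  set s := logDist G p
  set st := logDistTime G G' p
  set r := ‖p.1‖
  have hr0 : 0 ≤ r := norm_nonneg _
  have hβs : 1 ≤ β * |s| := by nlinarith
  have haM : a ≤ M * r := ha.trans (by gcongr; nlinarith)
  have b1 : |β * s * st * N| ≤ β * |s| * (M ^ 2 * N) := by
    rw [abs_mul, abs_mul, abs_mul, abs_of_nonneg hN, abs_of_nonneg (by linarith : 0 ≤ β), mul_assoc]
    gcongr
  have b3 : |(1 / 2) * (4 - n) * st * N| ≤ (n + 4) / 2 * (β * |s| * (M ^ 2 * N)) := by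
    have hn : |(4 : ℝ) - n| ≤ n + 4 := by
      refine (abs_sub _ _).trans ?_
      rw [abs_of_pos (by norm_num : (0 : ℝ) < 4), Nat.abs_cast]; linarith
    rw [abs_mul, abs_mul, abs_mul, abs_of_nonneg hN, abs_of_pos (by norm_num : (0 : ℝ) < 1 / 2)]
    calc _ ≤ 1 / 2 * (n + 4) * M ^ 2 * N := by gcongr
      _ = (n + 4) / 2 * (1 * (M ^ 2 * N)) := by ring
      _ ≤ _ := by gcongr
  have b4 : |(1 / 2) * inner ℝ (A' (0, 1) g) g| ≤ 1 / 2 * (β * |s| * (M ^ 2 * N)) := by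
    rw [abs_mul, abs_of_pos (by norm_num : (0 : ℝ) < 1 / 2)]
    gcongr
    calc _ ≤ M * ‖g‖ * ‖g‖ := abs_inner_le_of_le (hb.norm_A'_time _) le_rfl
      _ = M * ‖g‖ ^ 2 := by ring
      _ ≤ M * (M * N) := by gcongr
      _ = 1 * (M ^ 2 * N) := by ring
      _ ≤ _ := by gcongr
  -- The factor `σ²` pays for the singular factor `1 / |x|` of `∂ₜ∇φ`.
  have b2 : a * |v * inner ℝ (A p g) (weightGradTime G G' β p)|
      ≤ 2 * M ^ 7 * (β * |s|) * r * (v ^ 2 + N) := by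
    rw [abs_mul]
    have c1 : |inner ℝ (A p g) (weightGradTime G G' β p)|
        ≤ M * ‖g‖ * ‖weightGradTime G G' β p‖ := abs_inner_le_of_le (hb.norm_A _) le_rfl
    have c2 : 2 * (|v| * ‖g‖) ≤ M * (v ^ 2 + N) := by
      nlinarith [sq_nonneg (|v| - ‖g‖), sq_abs v, sq_nonneg v]
    calc _ ≤ (M * r ^ 2) * (|v| * (M * ‖g‖ * ‖weightGradTime G G' β p‖)) := by gcongr
      _ = M ^ 2 * r * (|v| * ‖g‖) * (‖weightGradTime G G' β p‖ * r) := by ring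
      _ ≤ M ^ 2 * r * (|v| * ‖g‖) * (4 * M ^ 4 * (β * |s|)) := by gcongr
      _ = 2 * M ^ 6 * (β * |s|) * r * (2 * (|v| * ‖g‖)) := by ring
      _ ≤ 2 * M ^ 6 * (β * |s|) * r * (M * (v ^ 2 + N)) := by gcongr
      _ = _ := by ring
  have b5 : |β * s * st * N + v * inner ℝ (A p g) (weightGradTime G G' β p)
        + (1 / 2) * (4 - n) * st * N + (1 / 2) * inner ℝ (A' (0, 1) g) g|
      ≤ |v * inner ℝ (A p g) (weightGradTime G G' β p)|
        + (n + 7) / 2 * (β * |s| * (M ^ 2 * N)) := by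
    refine ((abs_add_le _ _).trans (add_le_add ((abs_add_le _ _).trans (add_le_add
      (abs_add_le _ _) le_rfl)) le_rfl)).trans ?_
    linarith
  rw [abs_mul, abs_of_nonneg (by positivity : 0 ≤ a ^ 2)]
  have hZ : 0 ≤ β * |s| * r := by positivity
  have d1 : a * (2 * M ^ 7 * (β * |s|) * r * (v ^ 2 + N))
      ≤ 2 * M ^ 8 * (β * |s| * r) * (v ^ 2 + a * N) := by
    calc _ = 2 * M ^ 7 * (β * |s| * r) * (a * v ^ 2 + a * N) := by ring
      _ ≤ 2 * M ^ 7 * (β * |s| * r) * (M * v ^ 2 + M * (a * N)) := by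
        refine mul_le_mul_of_nonneg_left (add_le_add (mul_le_mul_of_nonneg_right ?_ (sq_nonneg v))
          (le_mul_of_one_le_left (by positivity) hM)) (by positivity)
        exact haM.trans (mul_le_of_le_one_right h4.le hr)
      _ = _ := by ring
  have d2 : a ^ 2 * ((n + 7) / 2 * (β * |s| * (M ^ 2 * N)))
      ≤ (n + 7) / 2 * M ^ 8 * (β * |s| * r) * (a * N) := by
    calc _ = a * ((n + 7) / 2 * (β * |s|) * (M ^ 2 * (a * N))) := by ring
      _ ≤ (M * r) * ((n + 7) / 2 * (β * |s|) * (M ^ 2 * (a * N))) := by gcongr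
      _ = (n + 7) / 2 * M ^ 3 * (β * |s| * r) * (a * N) := by ring
      _ ≤ _ := by gcongr; norm_num
  have hX : 0 ≤ M ^ 8 * (β * |s| * r) * (a * N) := by positivity
  have hY : 0 ≤ M ^ 8 * (β * |s| * r) * v ^ 2 := by positivity
  calc _ ≤ a ^ 2 * (|v * inner ℝ (A p g) (weightGradTime G G' β p)|
        + (n + 7) / 2 * (β * |s| * (M ^ 2 * N))) := by gcongr
    _ = a * (a * |v * inner ℝ (A p g) (weightGradTime G G' β p)|)
        + a ^ 2 * ((n + 7) / 2 * (β * |s| * (M ^ 2 * N))) := by ring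
    _ ≤ 2 * M ^ 8 * (β * |s| * r) * (v ^ 2 + a * N)
        + (n + 7) / 2 * M ^ 8 * (β * |s| * r) * (a * N) :=
      add_le_add ((mul_le_mul_of_nonneg_left b2 ha0).trans d1) d2
    _ = (2 + (n + 7) / 2) * (M ^ 8 * (β * |s| * r) * (a * N))
        + 2 * (M ^ 8 * (β * |s| * r) * v ^ 2) := by ring
    _ ≤ (n + 8) * (M ^ 8 * (β * |s| * r) * (a * N))
        + (n + 8) * (M ^ 8 * (β * |s| * r) * v ^ 2) := by
      exact add_le_add (mul_le_mul_of_nonneg_right (by linarith) hX)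
        (mul_le_mul_of_nonneg_right (by linarith) hY)
    _ = _ := by ring

theorem abs_zeroth_error_le (hb : BoundedAt M A G p A' G') (h : RegularAt A G p A' G')
    (hq2 : |eikonal A G p| ≤ 2) :
    |eikonal A G p * divergence (radialField A G) p - n * eikonal A G p ^ 2
        + fderiv ℝ (eikonal A G) p (radialField A G p, 0)| ≤ (6 * n + 7) * M ^ 6 * ‖p.1‖ := by
  have hM := hb.one_le
  have h4 := hb.pos
  have hδ := hb.abs_divergence_radialField_sub h
  have hq := hb.abs_eikonal_sub_one h.quad_pos
  have hd := hb.abs_deriv_eikonal_radial h hq2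
  set δ := divergence (radialField A G) p
  set q := eikonal A G p
  have e : q * δ - n * q ^ 2 + fderiv ℝ (eikonal A G) p (radialField A G p, 0)
      = q * (δ - n) - n * q * (q - 1) + fderiv ℝ (eikonal A G) p (radialField A G p, 0) := by ring
  rw [e]
  have b1 : |q * (δ - n)| ≤ 4 * n * (M ^ 6 * ‖p.1‖) := by
    rw [abs_mul]
    calc _ ≤ 2 * (2 * n * M ^ 2 * ‖p.1‖) := by gcongr
      _ = 4 * n * (M ^ 2 * ‖p.1‖) := by ring
      _ ≤ _ := by gcongr; norm_num
  have b2 : |n * q * (q - 1)| ≤ 2 * n * (M ^ 6 * ‖p.1‖) := by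
    rw [abs_mul, abs_mul, Nat.abs_cast]
    calc _ ≤ n * 2 * (M ^ 3 * ‖p.1‖) := by gcongr
      _ = 2 * n * (M ^ 3 * ‖p.1‖) := by ring
      _ ≤ _ := by gcongr; norm_num
  refine ((abs_add_le _ _).trans (add_le_add ((abs_sub _ _).trans (add_le_add b1 b2)) hd)).trans ?_
  exact le_of_eq (by ring)

theorem abs_time_zeroth_error_le (hb : BoundedAt M A G p A' G') (h : RegularAt A G p A' G')
    (hβ : 1 ≤ β) (hs : 1 ≤ |logDist G p|) (hq2 : |eikonal A G p| ≤ 2) :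
    |(2 - n) * logDistTime G G' p * logDist G p ^ 2 * eikonal A G p
        + 2 * logDist G p * logDistTime G G' p * eikonal A G p
        + logDist G p ^ 2 * fderiv ℝ (eikonal A G) p (0, 1)
        + 2 * β * logDist G p ^ 3 * logDistTime G G' p * eikonal A G p|
      ≤ (2 * n + 19) * M ^ 4 * (β * |logDist G p| ^ 3) := by
  have hM := hb.one_le
  have h4 := hb.pos
  have hst := hb.abs_logDistTime_le h.quad_pos
  have hd := hb.abs_deriv_eikonal_time h hq2
  set q := eikonal A G p
  set s := logDist G p
  set st := logDistTime G G' p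
  have hn0 : (0 : ℝ) ≤ n := Nat.cast_nonneg n
  have hM2 : M ^ 2 ≤ M ^ 4 := by gcongr; norm_num
  have hs1 : |s| ≤ |s| ^ 3 := le_self_pow₀ hs (by norm_num)
  have hs2 : |s| ^ 2 ≤ |s| ^ 3 := by gcongr; norm_num
  have hX : |s| ^ 3 ≤ β * |s| ^ 3 := le_mul_of_one_le_left (by positivity) hβ
  have c1 : |(2 - n) * st * s ^ 2 * q| ≤ 2 * (n + 2) * (M ^ 4 * (β * |s| ^ 3)) := by
    have hn : |(2 : ℝ) - n| ≤ n + 2 := by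
      refine (abs_sub _ _).trans ?_
      rw [abs_two, Nat.abs_cast]; linarith
    rw [abs_mul, abs_mul, abs_mul, abs_pow]
    calc _ ≤ (n + 2) * M ^ 4 * (β * |s| ^ 3) * 2 := by
          gcongr
          · exact hst.trans hM2
          · exact hs2.trans hX
      _ = _ := by ring
  have c2 : |2 * s * st * q| ≤ 4 * (M ^ 4 * (β * |s| ^ 3)) := by
    rw [abs_mul, abs_mul, abs_mul, abs_two]
    calc _ ≤ 2 * (β * |s| ^ 3) * M ^ 4 * 2 := by
          gcongr
          · exact hs1.trans hX
          · exact hst.trans hM2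
      _ = _ := by ring
  have c3 : |s ^ 2 * fderiv ℝ (eikonal A G) p (0, 1)| ≤ 7 * (M ^ 4 * (β * |s| ^ 3)) := by
    rw [abs_mul, abs_pow]
    calc _ ≤ (β * |s| ^ 3) * (7 * M ^ 4) := by
          gcongr
          exact hs2.trans hX
      _ = _ := by ring
  have c4 : |2 * β * s ^ 3 * st * q| ≤ 4 * (M ^ 4 * (β * |s| ^ 3)) := by
    rw [abs_mul, abs_mul, abs_mul, abs_mul, abs_two, abs_pow, abs_of_nonneg (by linarith : 0 ≤ β)]
    calc _ ≤ 2 * β * |s| ^ 3 * M ^ 4 * 2 := by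
          gcongr
          exact hst.trans hM2
      _ = _ := by ring
  refine ((abs_add_le _ _).trans (add_le_add ((abs_add_le _ _).trans (add_le_add
      ((abs_add_le _ _).trans (add_le_add c1 c2)) c3)) c4)).trans ?_
  exact le_of_eq (by ring)

theorem abs_carlemanError_le (hb : BoundedAt M A G p A' G') (h : RegularAt A G p A' G')
    (hr : ‖p.1‖ ≤ 1) (hβ : 1 ≤ β) (hs : 1 ≤ |logDist G p|) (hq2 : |eikonal A G p| ≤ 2) :
    |carlemanError A G β u A' G' p| ≤ (25 + 10 * n) * M ^ 8 * (‖p.1‖ * |logDist G p|) *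
      (β * Real.exp (2 * logDist G p) * inner ℝ (A p (conjGrad G β u p)) (conjGrad G β u p)
        + β ^ 3 * logDist G p ^ 2 * conjFun G β u p ^ 2) := by
  have hM := hb.one_le
  have h4 := hb.pos
  have hN := hb.energy_nonneg (conjGrad G β u p)
  have ha := hb.exp_le h.quad_pos
  have ha0 := (Real.exp_pos (2 * logDist G p)).le
  have h1 := hb.abs_spatial_error_le h (conjGrad G β u p)
  have h2 := hb.abs_time_error_le h hr hβ hs (conjFun G β u p) (conjGrad G β u p)
  have h3 := hb.abs_zeroth_error_le h hq2
  have h5 := hb.abs_time_zeroth_error_le (β := β) h hβ hs hq2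
  have hn0 : (0 : ℝ) ≤ n := Nat.cast_nonneg n
  rw [carlemanError]
  set N := inner ℝ (A p (conjGrad G β u p)) (conjGrad G β u p)
  set a := Real.exp (2 * logDist G p)
  set s := logDist G p
  set v := conjFun G β u p
  set r := ‖p.1‖
  have hr0 : 0 ≤ r := norm_nonneg _
  have hss : s ^ 2 = |s| ^ 2 := (sq_abs s).symm
  have haM : a ≤ M * r := ha.trans (by gcongr; nlinarith)
  have hβ3 : β ≤ β ^ 3 * |s| ^ 2 := by
    calc β ≤ β ^ 3 := le_self_pow₀ hβ (by norm_num)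
      _ ≤ β ^ 3 * |s| ^ 2 := le_mul_of_one_le_right (by positivity) (one_le_pow₀ hs)
  refine ((abs_sub _ _).trans (add_le_add ((abs_sub _ _).trans (add_le_add
      ((abs_add_le _ _).trans (add_le_add ?_ h2)) ?_)) ?_)).trans
      (?_ : (8 + 4 * n) * M ^ 8 * (r * |s|) * (β * a * N)
        + (n + 8) * M ^ 8 * (r * |s|) * (β * (a * N + v ^ 2))
        + (6 * n + 7) * M ^ 8 * (r * |s|) * (β ^ 3 * s ^ 2 * v ^ 2)
        + (n + 10) * M ^ 8 * (r * |s|) * (β ^ 3 * s ^ 2 * v ^ 2) ≤ _)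
  · rw [abs_mul, abs_mul, abs_mul, abs_mul, abs_of_nonneg ha0,
      abs_of_nonneg (by linarith : 0 ≤ β)]
    calc _ ≤ |(-2 : ℝ)| * β * |s| * a * ((4 + 2 * n) * M ^ 8 * r * N) := by
          gcongr
          refine h1.trans ?_
          gcongr
          norm_num
      _ = _ := by rw [abs_neg, abs_two]; ring
  · rw [abs_mul, abs_mul, abs_mul, abs_pow, abs_pow, abs_pow, abs_of_nonneg (by linarith : 0 ≤ β)]
    calc _ ≤ β ^ 3 * |s| ^ 3 * |v| ^ 2 * ((6 * n + 7) * M ^ 8 * r) := by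
          gcongr
          refine h3.trans ?_
          gcongr
          norm_num
      _ = _ := by rw [sq_abs, hss]; ring
  · rw [abs_mul, abs_mul, abs_mul, abs_mul, abs_pow, abs_pow, abs_of_nonneg (by linarith : 0 ≤ β),
      abs_of_nonneg ha0, abs_of_pos (by norm_num : (0 : ℝ) < 1 / 2)]
    calc _ ≤ 1 / 2 * β ^ 2 * (M * r) * |v| ^ 2 * ((2 * n + 19) * M ^ 4 * (β * |s| ^ 3)) := by
          gcongr
      _ = (n + 9.5) * M ^ 5 * (r * |s|) * (β ^ 3 * s ^ 2 * v ^ 2) := by rw [sq_abs, hss]; ring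
      _ ≤ _ := by
          gcongr
          · norm_num
          · norm_num
  · have c : β * (a * N + v ^ 2) ≤ β * a * N + β ^ 3 * s ^ 2 * v ^ 2 := by
      rw [hss]
      nlinarith [mul_le_mul_of_nonneg_right hβ3 (sq_nonneg v)]
    have hβ0 : 0 ≤ β := by linarith
    have hX : 0 ≤ β * a * N := by positivity
    have hY : 0 ≤ β ^ 3 * s ^ 2 * v ^ 2 := by positivity
    have hZ : 0 ≤ M ^ 8 * (r * |s|) := by positivity
    set X := β * a * N
    set Y := β ^ 3 * s ^ 2 * v ^ 2
    calc _ = M ^ 8 * (r * |s|) * ((8 + 4 * n) * X + (n + 8) * (β * (a * N + v ^ 2))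
          + (7 * n + 17) * Y) := by ring
      _ ≤ M ^ 8 * (r * |s|) * ((25 + 10 * n) * (X + Y)) := by
          gcongr
          nlinarith [mul_nonneg hn0 hX, mul_nonneg hn0 hY, mul_le_mul_of_nonneg_left c
            (by linarith : (0 : ℝ) ≤ n + 8)]
      _ = _ := by ring

end BoundedAt

/-! ### The pointwise inequality -/

/-- Absorption of the lower-order terms. Here `S + B + E` is the conjugated operator, `y` the radial
derivative, `N` the energy `σ² ⟨A∇v, ∇v⟩`, and `Err` the error due to variable coefficients. The
mixed term `-2βv S` added to `B S` trades `v`-terms for gradient terms and makes both coefficients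
positive. -/
theorem absorb_lower_order {S B E y v N q s β Err k c : ℝ} (hs : s ≤ -1)
    (hq : |q - 1| ≤ 1 / 10) (hN : 0 ≤ N) (hβ : 8 + 4 * k ^ 2 + 8 * c ^ 2 ≤ β)
    (hE : E ^ 2 ≤ 2 * k ^ 2 * y ^ 2 + 2 * (β ^ 2 * s ^ 2 * c ^ 2 * v ^ 2))
    (hErr : |Err| ≤ 1 / 8 * (β * N + β ^ 3 * s ^ 2 * v ^ 2)) :
    1 / 2 * (β * N + β ^ 3 * s ^ 2 * v ^ 2) ≤ 2 * (S + B + E) ^ 2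
      - 2 * ((B - 2 * β * v) * S + 2 * y * B - (-4 * β * s + 2 * β) * y ^ 2 - β * (2 - q) * N
        - β ^ 3 * s ^ 2 * (3 * q ^ 2 - 2 * q) * v ^ 2 + Err) := by
  obtain ⟨hq1, hq2⟩ := abs_le.1 hq
  have hk := sq_nonneg k
  have hc := sq_nonneg c
  have hβ1 : 8 ≤ β := by linarith
  have hErr' := (abs_le.1 hErr).2
  have h1 : 0 ≤ (S + B + 2 * E) ^ 2 + (S + 2 * β * v) ^ 2 + (B - 2 * y) ^ 2 := by positivity
  have h2 : 0 ≤ (4 * β - 4 - 4 * k ^ 2) * y ^ 2 :=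
    mul_nonneg (by linarith) (sq_nonneg y)
  have h3 : 0 ≤ -(8 * β * s * y ^ 2) := by
    have : 0 ≤ β * -s * y ^ 2 := mul_nonneg (mul_nonneg (by linarith) (by linarith)) (sq_nonneg y)
    linarith
  have h4 : 9 / 10 * (β * N) ≤ β * (2 - q) * N := by
    have : 0 ≤ (11 / 10 - q) * (β * N) :=
      mul_nonneg (by linarith) (mul_nonneg (by linarith) hN)
    linarith
  have hX : 0 ≤ β ^ 2 * s ^ 2 * v ^ 2 := by positivity
  have hqq : 63 / 100 ≤ 3 * q ^ 2 - 2 * q := by nlinarith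
  have h5 : 63 / 100 * (β ^ 3 * s ^ 2 * v ^ 2)
      ≤ β ^ 3 * s ^ 2 * (3 * q ^ 2 - 2 * q) * v ^ 2 := by
    have : 0 ≤ (3 * q ^ 2 - 2 * q - 63 / 100) * (β * (β ^ 2 * s ^ 2 * v ^ 2)) :=
      mul_nonneg (by linarith) (mul_nonneg (by linarith) hX)
    linarith
  have h6 : β ^ 2 * v ^ 2 ≤ β ^ 2 * s ^ 2 * v ^ 2 := by
    have : 1 ≤ s ^ 2 := by nlinarith
    nlinarith [mul_nonneg (sub_nonneg.2 this) (mul_nonneg (sq_nonneg β) (sq_nonneg v))]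
  have h7 : (8 + 8 * c ^ 2) * (β ^ 2 * s ^ 2 * v ^ 2) ≤ β ^ 3 * s ^ 2 * v ^ 2 := by
    have : 0 ≤ (β - 8 - 8 * c ^ 2) * (β ^ 2 * s ^ 2 * v ^ 2) := mul_nonneg (by linarith) hX
    linarith
  have hβN : 0 ≤ β * N := mul_nonneg (by linarith) hN
  have hcX : 0 ≤ c ^ 2 * (β ^ 2 * s ^ 2 * v ^ 2) := mul_nonneg hc hX
  nlinarith

/-- The pointwise inequality in terms of the real numbers that enter it: `δ` is the divergence of
the radial field, `Nu` the energy of the function before conjugation. -/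
theorem pointwise_absorption {S B y v N Nu q s β δ m C Err : ℝ} (hs : s ≤ -1)
    (hq : |q - 1| ≤ 1 / 10) (hδ : |δ - 2 * q| ≤ C) (hN : 0 ≤ N)
    (hβ : 8 + 4 * m ^ 2 + 8 * (2 + C) ^ 2 ≤ β)
    (hErr : |Err| ≤ 1 / 8 * (β * N + β ^ 3 * s ^ 2 * v ^ 2))
    (hNu : Nu ≤ 2 * N + 2 * (β ^ 2 * s ^ 2 * q * v ^ 2)) :
    β ^ 3 * v ^ 2 + β * Nu ≤ 16 * (S + B + m * y - β * q * v - β * s * (δ - 2 * q) * v) ^ 2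
      - 16 * ((B - 2 * β * v) * S + 2 * y * B - (-4 * β * s + 2 * β) * y ^ 2 - β * (2 - q) * N
        - β ^ 3 * s ^ 2 * (3 * q ^ 2 - 2 * q) * v ^ 2 + Err) := by
  have hβ0 : 0 ≤ β := by nlinarith [sq_nonneg m, sq_nonneg (2 + C)]
  have hs1 : 1 ≤ |s| := by rw [abs_of_nonpos (by linarith)]; linarith
  obtain ⟨hq1, hq2⟩ := abs_le.1 hq
  have hq3 : |q| ≤ 2 := abs_le.2 ⟨by linarith, by linarith⟩
  have hb1 : |β * q + β * s * (δ - 2 * q)| ≤ β * |s| * (2 + C) := by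
    calc _ ≤ |β * q| + |β * s * (δ - 2 * q)| := abs_add_le _ _
      _ = β * |q| + β * |s| * |δ - 2 * q| := by rw [abs_mul, abs_mul, abs_mul, abs_of_nonneg hβ0]
      _ ≤ β * (|s| * 2) + β * |s| * C := by
        refine add_le_add (mul_le_mul_of_nonneg_left ?_ hβ0)
          (mul_le_mul_of_nonneg_left hδ (by positivity))
        linarith
      _ = _ := by ring
  have hb2 : (β * q + β * s * (δ - 2 * q)) ^ 2 ≤ β ^ 2 * s ^ 2 * (2 + C) ^ 2 := by
    rw [← sq_abs (_ + _), ← sq_abs s, ← mul_pow, ← mul_pow]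
    exact pow_le_pow_left₀ (abs_nonneg _) hb1 2
  have hE : (m * y - (β * q + β * s * (δ - 2 * q)) * v) ^ 2 ≤ 2 * m ^ 2 * y ^ 2
      + 2 * (β ^ 2 * s ^ 2 * (2 + C) ^ 2 * v ^ 2) := by
    have h1 := mul_le_mul_of_nonneg_right hb2 (sq_nonneg v)
    have h2 := sq_nonneg (m * y + (β * q + β * s * (δ - 2 * q)) * v)
    linarith
  have key := absorb_lower_order (S := S) (B := B) hs hq hN hβ hE hErr
  have e1 : S + B + m * y - β * q * v - β * s * (δ - 2 * q) * v
      = S + B + (m * y - (β * q + β * s * (δ - 2 * q)) * v) := by ring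
  rw [e1]
  have hv : β ^ 3 * v ^ 2 ≤ β ^ 3 * s ^ 2 * v ^ 2 := by
    have h1 : 0 ≤ s ^ 2 - 1 := by nlinarith
    have h2 : 0 ≤ (s ^ 2 - 1) * (β ^ 3 * v ^ 2) := by positivity
    linarith
  have hu2 : β * Nu ≤ 2 * (β * N) + 11 / 5 * (β ^ 3 * s ^ 2 * v ^ 2) := by
    have h1 := mul_le_mul_of_nonneg_left hNu hβ0
    have h3 : 0 ≤ 11 / 10 - q := by linarith
    have h2 : 0 ≤ (11 / 10 - q) * (β ^ 3 * s ^ 2 * v ^ 2) := by positivity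
    linarith
  have hβN : 0 ≤ β * N := mul_nonneg hβ0 hN
  have hv0 : 0 ≤ β ^ 3 * s ^ 2 * v ^ 2 := by positivity
  linarith

variable {M β : ℝ} {A : Space n × ℝ → Space n →L[ℝ] Space n} {G : ℝ → Space n →L[ℝ] Space n}
  {u : Space n × ℝ → ℝ}
  {p : Space n × ℝ} {A' : Space n × ℝ → Space n →L[ℝ] Space n} {G' : Space n →L[ℝ] Space n}

/-- The energy of `u` is controlled by that of `v` and by `v` itself, through
`e^{β s² / 2} ∇u = ∇v - v ∇(β s² / 2)` and the parallelogram law for the form `A`. -/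
theorem energy_le_conjugated (hb : BoundedAt M A G p A' G') :
    Real.exp (2 * logDist G p) * (conjFactor G β p ^ 2
      * inner ℝ (A p (spaceGrad u p)) (spaceGrad u p))
    ≤ 2 * (Real.exp (2 * logDist G p) * inner ℝ (A p (conjGrad G β u p)) (conjGrad G β u p))
      + 2 * (β ^ 2 * logDist G p ^ 2 * eikonal A G p * conjFun G β u p ^ 2) := by
  set z : Space n := (β * (logDist G p * Real.exp (-2 * logDist G p) * conjFun G β u p)) • G p.2 p.1
    with hz
  have h2 : Real.exp (2 * logDist G p) * Real.exp (-2 * logDist G p) = 1 := by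
    rw [← Real.exp_add]; simp
  have hg : conjFactor G β p • spaceGrad u p = conjGrad G β u p - z := by
    rw [conjGrad, hz, add_sub_cancel_right]
  have e1 : conjFactor G β p ^ 2 * inner ℝ (A p (spaceGrad u p)) (spaceGrad u p)
      = inner ℝ (A p (conjGrad G β u p - z)) (conjGrad G β u p - z) := by
    rw [← hg, map_smul, inner_smul_left, inner_smul_right]
    simp only [conj_trivial]; ring
  have e2 : Real.exp (2 * logDist G p) * inner ℝ (A p z) z
      = β ^ 2 * logDist G p ^ 2 * eikonal A G p * conjFun G β u p ^ 2 := by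
    rw [hz, map_smul, inner_smul_left, inner_smul_right, eikonal, radialField]
    simp only [conj_trivial]
    linear_combination (β ^ 2 * logDist G p ^ 2 * conjFun G β u p ^ 2
      * Real.exp (-2 * logDist G p) * inner ℝ (A p (G p.2 p.1)) (G p.2 p.1)) * h2
  have e3 : inner ℝ (A p (conjGrad G β u p - z)) (conjGrad G β u p - z)
      + inner ℝ (A p (conjGrad G β u p + z)) (conjGrad G β u p + z)
      = 2 * inner ℝ (A p (conjGrad G β u p)) (conjGrad G β u p) + 2 * inner ℝ (A p z) z := by
    simp only [map_add, map_sub, inner_add_left, inner_add_right, inner_sub_left, inner_sub_right]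
    ring
  have e4 := hb.energy_nonneg (conjGrad G β u p + z)
  rw [e1, ← e2, ← mul_add, ← mul_add] at *
  nlinarith [Real.exp_pos (2 * logDist G p)]

/-- The Carleman estimate holds pointwise up to a divergence. -/
theorem carleman_pointwise (hb : BoundedAt M A G p A' G') (h : RegularAt A G p A' G')
    (hu : ContDiff ℝ ∞ u) (hr : ‖p.1‖ ≤ 1) (hs : logDist G p ≤ -1)
    (hsmall : (25 + 10 * n) * M ^ 8 * (‖p.1‖ * |logDist G p|) ≤ 1 / 8)
    (hMr : M ^ 3 * ‖p.1‖ ≤ 1 / 10)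
    (hβ : 8 + 4 * ((n : ℝ) - 2) ^ 2 + 8 * (6 + 3 * n * M ^ 2) ^ 2 ≤ β) :
    Real.exp (-n * logDist G p) * (β ^ 3 * conjFun G β u p ^ 2
      + β * (Real.exp (2 * logDist G p) * (conjFactor G β p ^ 2
        * inner ℝ (A p (spaceGrad u p)) (spaceGrad u p))))
    ≤ 16 * (Real.exp (-n * logDist G p) * (Real.exp (2 * logDist G p) * conjFactor G β p *
        (divergence (fun x => A x (spaceGrad u x)) p - timeDeriv u p)) ^ 2)
      - 16 * (divergence (carlemanField A G β u) p
        + fderiv ℝ (carlemanTime A G β u) p (0, 1)) := by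
  have hM := hb.one_le
  have hn0 : (0 : ℝ) ≤ n := Nat.cast_nonneg n
  have hβ8 : 8 ≤ β := by nlinarith [sq_nonneg ((n : ℝ) - 2), sq_nonneg (6 + 3 * n * M ^ 2)]
  have hq := (hb.abs_eikonal_sub_one h.quad_pos).trans hMr
  have hsabs : |logDist G p| = -logDist G p := abs_of_nonpos (by linarith)
  have hs1 : 1 ≤ |logDist G p| := by linarith
  obtain ⟨hq1, hq2⟩ := abs_le.1 hq
  have hqabs : |eikonal A G p| ≤ 2 := abs_le.2 ⟨by linarith, by linarith⟩
  have hErr := hb.abs_carlemanError_le (u := u) h hr (by linarith : 1 ≤ β) hs1 hqabs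
  have hN := hb.energy_nonneg (conjGrad G β u p)
  have hδ := hb.abs_divergence_radialField_sub h
  have hen := energy_le_conjugated (β := β) (u := u) hb
  rw [conjugated_operator h hu, divergence_carlemanField h hu]
  have ha0 := (Real.exp_pos (2 * logDist G p)).le
  have hμ := (Real.exp_pos (-n * logDist G p)).le
  set a := Real.exp (2 * logDist G p)
  set μ := Real.exp (-n * logDist G p)
  set N := inner ℝ (A p (conjGrad G β u p)) (conjGrad G β u p)
  set y := inner ℝ (radialField A G p) (conjGrad G β u p)
  set v := conjFun G β u p
  set s := logDist G p
  set q := eikonal A G p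
  set δ := divergence (radialField A G) p
  set S := symmPart A G β u p
  set B := antisymmPart A G β u p
  set Err := carlemanError A G β u A' G' p
  set Nu := conjFactor G β p ^ 2 * inner ℝ (A p (spaceGrad u p)) (spaceGrad u p)
  have hβ0 : 0 ≤ β := by linarith
  have hErr' : |Err| ≤ 1 / 8 * (β * (a * N) + β ^ 3 * s ^ 2 * v ^ 2) := by
    refine hErr.trans ?_
    rw [mul_assoc β]
    exact mul_le_mul_of_nonneg_right hsmall (by positivity)
  have hδ' : |δ - 2 * q| ≤ 4 + 3 * n * M ^ 2 := by
    have h1 : |δ - n| ≤ 2 * n * M ^ 2 := hδ.trans (mul_le_of_le_one_right (by positivity) hr)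
    have h2 : (n : ℝ) ≤ n * M ^ 2 := le_mul_of_one_le_right hn0 (one_le_pow₀ hM)
    rw [abs_le] at h1 hqabs ⊢
    constructor <;> linarith
  have key := pointwise_absorption (S := S) (B := B) (y := y) (m := n - 2) hs hq hδ'
    (mul_nonneg ha0 hN) (by linarith) hErr' hen
  refine (mul_le_mul_of_nonneg_left key hμ).trans_eq ?_
  ring

/-- Near the origin `|x| |log σ|` is small, uniformly in the coefficients. -/
theorem exists_radius (M c : ℝ) (hM : 1 ≤ M) (hc : 0 ≤ c) :
    ∃ R₀ > (0 : ℝ), ∀ r : ℝ, 0 < r → r ≤ R₀ → ∀ a : ℝ, r ^ 2 ≤ M * a → a ≤ M * r ^ 2 →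
      r ≤ 1 ∧ (1 / 2) * Real.log a ≤ -1 ∧ c * (r * |(1 / 2) * Real.log a|) ≤ 1 / 8 ∧
        M ^ 3 * r ≤ 1 / 10 := by
  have h0 : ∀ f : ℝ → ℝ, Continuous f → Tendsto f (𝓝[>] 0) (𝓝 (f 0)) := fun f hf =>
    hf.continuousAt.tendsto.mono_left nhdsWithin_le_nhds
  have t1 := h0 (fun r => M ^ 3 * r) (by fun_prop)
  have t2 := h0 (fun r => r) (by fun_prop)
  have t3 := h0 (fun r => M * r ^ 2) (by fun_prop)
  have t5 := h0 (fun r => c * (r * (1 / 2 * Real.log M)) - c * (r * Real.log r))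
    ((by fun_prop : Continuous fun r : ℝ => c * (r * (1 / 2 * Real.log M))).sub
      (Real.continuous_mul_log.const_mul c))
  simp only [mul_zero, ne_eq, OfNat.ofNat_ne_zero, not_false_eq_true, zero_pow, zero_mul,
    sub_zero] at t1 t3 t5
  have ev := ((t1.eventually (ge_mem_nhds (by norm_num : (0 : ℝ) < 1 / 10))).and
    (t2.eventually (ge_mem_nhds (one_pos : (0 : ℝ) < 1)))).and
    ((t3.eventually (ge_mem_nhds (Real.exp_pos (-2)))).and
    (t5.eventually (ge_mem_nhds (by norm_num : (0 : ℝ) < 1 / 8))))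
  obtain ⟨R₀, hR, hsub⟩ := mem_nhdsGT_iff_exists_Ioc_subset.1 ev
  refine ⟨R₀, hR, fun r hr0 hr a ha1 ha2 => ?_⟩
  obtain ⟨⟨k1, k2⟩, k3, k4⟩ := hsub ⟨hr0, hr⟩
  have hM0 : 0 < M := by linarith
  have ha0 : 0 < a := by
    have : 0 < M * a := lt_of_lt_of_le (by positivity) ha1
    exact (pos_iff_pos_of_mul_pos this).1 hM0
  have hs : (1 / 2) * Real.log a ≤ -1 := by
    have := (Real.log_le_log ha0 (ha2.trans k3)).trans_eq (Real.log_exp _)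
    linarith
  refine ⟨k2, hs, ?_, k1⟩
  have hl := Real.log_le_log (by positivity) ha1
  rw [Real.log_mul hM0.ne' ha0.ne', Real.log_pow] at hl
  push_cast at hl
  rw [abs_of_nonpos (by linarith)]
  refine le_trans ?_ k4
  have : r * -(1 / 2 * Real.log a) ≤ r * (1 / 2 * Real.log M - Real.log r) := by
    gcongr
    linarith
  calc _ ≤ c * (r * (1 / 2 * Real.log M - Real.log r)) := by gcongr
    _ = _ := by ring

/-! ### Integration of the pointwise inequality -/

section Integration

variable {M β : ℝ} {A : Space n × ℝ → Space n →L[ℝ] Space n} {G : ℝ → Space n →L[ℝ] Space n}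
  {u : Space n × ℝ → ℝ} {p : Space n × ℝ}

theorem spaceGrad_eq_zero (hu : ContDiff ℝ ∞ u) (hp : p ∉ tsupport u) : spaceGrad u p = 0 := by
  have h : fderiv ℝ u p = 0 := by
    by_contra h0
    exact hp (support_fderiv_subset ℝ h0)
  rw [spaceGrad_eq hu, h]
  simp

theorem timeDeriv_eq_zero (hu : ContDiff ℝ ∞ u) (hp : p ∉ tsupport u) : timeDeriv u p = 0 := by
  have h : fderiv ℝ u p = 0 := by
    by_contra h0
    exact hp (support_fderiv_subset ℝ h0)
  rw [timeDeriv_eq hu, h]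
  simp

theorem conjFun_eq_zero (hp : p ∉ tsupport u) : conjFun G β u p = 0 := by
  rw [conjFun, image_eq_zero_of_notMem_tsupport hp, mul_zero]

theorem conjGrad_eq_zero (hu : ContDiff ℝ ∞ u) (hp : p ∉ tsupport u) :
    conjGrad G β u p = 0 := by
  rw [conjGrad, spaceGrad_eq_zero hu hp, conjFun_eq_zero hp]; simp

theorem conjTime_eq_zero (hu : ContDiff ℝ ∞ u) (hp : p ∉ tsupport u) :
    conjTime G β u p = 0 := by
  rw [conjTime, timeDeriv_eq_zero hu hp, mul_zero]

theorem carlemanField_eq_zero (hu : ContDiff ℝ ∞ u) (hp : p ∉ tsupport u) :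
    carlemanField A G β u p = 0 := by
  rw [carlemanField, conjGrad_eq_zero hu hp, conjTime_eq_zero hu hp, conjFun_eq_zero hp]; simp

theorem carlemanTime_eq_zero (hu : ContDiff ℝ ∞ u) (hp : p ∉ tsupport u) :
    carlemanTime A G β u p = 0 := by
  rw [carlemanTime, conjGrad_eq_zero hu hp, conjFun_eq_zero hp]; simp

theorem eventuallyEq_zero_of_notMem {V : Type*} [Zero V] {f : Space n × ℝ → V}
    (hf : ∀ x, x ∉ tsupport u → f x = 0) (hp : p ∉ tsupport u) :
    f =ᶠ[𝓝 p] fun _ => 0 :=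
  mem_of_superset ((isClosed_tsupport u).isOpen_compl.mem_nhds hp) hf

/-- A function built from Lipschitz ingredients on the support of `u` and vanishing off it is
locally Lipschitz. -/
theorem lipschitzNear_of_support {V : Type*} [NormedAddCommGroup V] [NormedSpace ℝ V]
    {f : Space n × ℝ → V} (hf : ∀ x, x ∉ tsupport u → f x = 0)
    (h : ∀ x ∈ tsupport u, LipschitzNear f x) (x : Space n × ℝ) : LipschitzNear f x := by
  by_cases hx : x ∈ tsupport u
  · exact h x hx
  · exact (LipschitzNear.const 0).congr (eventuallyEq_zero_of_notMem hf hx).symm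

section Near

variable (hA : LipschitzNear A p) (hG : LipschitzNear (fun x : Space n × ℝ => G x.2) p)
  (hq : 0 < quadDist G p) (hu : ContDiff ℝ ∞ u)

include hG in
theorem lipschitzNear_Gx : LipschitzNear (fun x : Space n × ℝ => G x.2 x.1) p :=
  hG.clm_apply (LipschitzNear.of_contDiff contDiff_fst)

include hG hq in
theorem lipschitzNear_logDist : LipschitzNear (logDist G) p :=
  (LipschitzNear.const (1 / 2)).mul (((lipschitzNear_Gx hG).inner
    (LipschitzNear.of_contDiff contDiff_fst)).log hq.ne')

include hG hq in
theorem lipschitzNear_exp_logDist (c : ℝ) :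
    LipschitzNear (fun x => Real.exp (c * logDist G x)) p :=
  ((LipschitzNear.const c).mul (lipschitzNear_logDist hG hq)).exp

include hA hG in
theorem lipschitzNear_radialField : LipschitzNear (radialField A G) p :=
  hA.clm_apply (lipschitzNear_Gx hG)

include hA hG hq in
theorem lipschitzNear_eikonal : LipschitzNear (eikonal A G) p :=
  (lipschitzNear_exp_logDist hG hq (-2)).mul
    ((lipschitzNear_radialField hA hG).inner (lipschitzNear_Gx hG))

include hG hq in
theorem lipschitzNear_conjFactor : LipschitzNear (conjFactor G β) p :=
  ((LipschitzNear.const (β / 2)).mul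
    ((lipschitzNear_logDist hG hq).mul (lipschitzNear_logDist hG hq))).exp

include hG hq hu in
theorem lipschitzNear_conjFun : LipschitzNear (conjFun G β u) p :=
  (lipschitzNear_conjFactor hG hq).mul (LipschitzNear.of_contDiff hu)

include hG hq hu in
theorem lipschitzNear_conjTime : LipschitzNear (conjTime G β u) p :=
  (lipschitzNear_conjFactor hG hq).mul (LipschitzNear.of_contDiff (contDiff_timeDeriv hu))

include hG hq hu in
theorem lipschitzNear_conjGrad : LipschitzNear (conjGrad G β u) p :=
  ((lipschitzNear_conjFactor hG hq).smul (LipschitzNear.of_contDiff (contDiff_spaceGrad hu))).add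
    (((LipschitzNear.const β).mul (((lipschitzNear_logDist hG hq).mul
      (lipschitzNear_exp_logDist hG hq (-2))).mul (lipschitzNear_conjFun hG hq hu))).smul
      (lipschitzNear_Gx hG))

include hA hG hq hu in
theorem lipschitzNear_carlemanField : LipschitzNear (carlemanField A G β u) p := by
  have hs := lipschitzNear_logDist hG hq
  have he := lipschitzNear_exp_logDist hG hq
  have hY := lipschitzNear_radialField hA hG
  have hq' := lipschitzNear_eikonal hA hG hq
  have hv := lipschitzNear_conjFun (β := β) hG hq hu
  have hg := lipschitzNear_conjGrad (β := β) hG hq hu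
  have hD := lipschitzNear_conjTime (β := β) hG hq hu
  have hAg := hA.clm_apply hg
  have hm := (he (-n)).mul (he 2)
  exact (((((LipschitzNear.const (-2 * β)).mul hs).mul (hY.inner hg)).sub ((he 2).mul hD)).sub
    ((LipschitzNear.const (2 * β)).mul hv)).smul (hm.smul hAg) |>.sub
    ((((LipschitzNear.const (-β)).mul ((hs.mul hm).mul (hAg.inner hg))).add
      ((LipschitzNear.const (β ^ 3)).mul ((he (-n)).mul (((hs.mul hs).mul hs).mul
        (hq'.mul (hv.mul hv)))))).smul hY)

include hA hG hq hu in
theorem lipschitzNear_carlemanTime : LipschitzNear (carlemanTime A G β u) p := by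
  have hs := lipschitzNear_logDist hG hq
  have he := lipschitzNear_exp_logDist hG hq
  have hq' := lipschitzNear_eikonal hA hG hq
  have hv := lipschitzNear_conjFun (β := β) hG hq hu
  have hg := lipschitzNear_conjGrad (β := β) hG hq hu
  exact ((LipschitzNear.const (1 / 2)).mul (((he (-n)).mul (he 4)).mul
    ((hA.clm_apply hg).inner hg))).sub ((LipschitzNear.const (β ^ 2 / 2)).mul
      ((((he (-n)).mul (he 2)).mul (hs.mul hs)).mul (hq'.mul (hv.mul hv))))

end Near

theorem measurable_divergence (Z : Space n × ℝ → Space n) : Measurable (divergence Z) := by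
  unfold divergence
  refine Finset.measurable_sum _ fun i _ => ?_
  have h : Measurable fun p => fderiv ℝ Z p (EuclideanSpace.single i 1, 0) :=
    measurable_fderiv_apply_const ℝ Z _
  exact (EuclideanSpace.proj i : Space n →L[ℝ] ℝ).measurable.comp h

theorem exists_bound_divergence {K : NNReal} {Z : Space n × ℝ → Space n}
    (hZ : LipschitzWith K Z) : ∃ C, ∀ p, |divergence Z p| ≤ C := by
  refine ⟨∑ i : Fin n, K * ‖((EuclideanSpace.single i (1 : ℝ) : Space n), (0 : ℝ))‖, fun p => ?_⟩
  refine (Finset.abs_sum_le_sum_abs _ _).trans (Finset.sum_le_sum fun i _ => ?_)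
  refine (PiLp.norm_apply_le (fderiv ℝ Z p (EuclideanSpace.single i 1, 0)) i).trans ?_
  exact (fderiv ℝ Z p).le_of_opNorm_le (norm_fderiv_le_of_lipschitz ℝ hZ) _

/-- The Carleman estimate for globally Lipschitz coefficients that satisfy the required bounds on
the support of `u`. -/
theorem integrated_carleman {K K' : NNReal} (hA : LipschitzWith K A) (hG : LipschitzWith K' G)
    (hu : ContDiff ℝ ∞ u) (hc : HasCompactSupport u)
    (hpos : ∀ p ∈ tsupport u, 0 < quadDist G p)
    (hsymmA : ∀ p ∈ tsupport u, ∀ ξ η, inner ℝ (A p ξ) η = inner ℝ (A p η) ξ)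
    (hsymmG : ∀ p ∈ tsupport u, ∀ ξ η, inner ℝ (G p.2 ξ) η = inner ℝ (G p.2 η) ξ)
    (hb : ∀ p ∈ tsupport u, DifferentiableAt ℝ A p → DifferentiableAt ℝ G p.2 →
      BoundedAt M A G p (fun w => fderiv ℝ A p w) (deriv G p.2))
    (hr : ∀ p ∈ tsupport u, ‖p.1‖ ≤ 1) (hs : ∀ p ∈ tsupport u, logDist G p ≤ -1)
    (hsmall : ∀ p ∈ tsupport u, (25 + 10 * n) * M ^ 8 * (‖p.1‖ * |logDist G p|) ≤ 1 / 8)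
    (hMr : ∀ p ∈ tsupport u, M ^ 3 * ‖p.1‖ ≤ 1 / 10)
    (hβ : 8 + 4 * ((n : ℝ) - 2) ^ 2 + 8 * (6 + 3 * n * M ^ 2) ^ 2 ≤ β) :
    Integrable (fun p => Real.exp (-n * logDist G p) * conjFun G β u p ^ 2) ∧
    Integrable (fun p => Real.exp (-n * logDist G p) * (Real.exp (2 * logDist G p)
      * (conjFactor G β p ^ 2 * inner ℝ (A p (spaceGrad u p)) (spaceGrad u p)))) ∧
    Integrable (fun p => Real.exp (-n * logDist G p) * (Real.exp (2 * logDist G p)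
      * conjFactor G β p * (divergence (fun x => A x (spaceGrad u x)) p - timeDeriv u p)) ^ 2) ∧
    β ^ 3 * (∫ p, Real.exp (-n * logDist G p) * conjFun G β u p ^ 2)
      + β * (∫ p, Real.exp (-n * logDist G p) * (Real.exp (2 * logDist G p)
        * (conjFactor G β p ^ 2 * inner ℝ (A p (spaceGrad u p)) (spaceGrad u p))))
      ≤ 16 * (∫ p, Real.exp (-n * logDist G p) * (Real.exp (2 * logDist G p)
      * conjFactor G β p * (divergence (fun x => A x (spaceGrad u x)) p - timeDeriv u p)) ^ 2) := by
  have hGs : LipschitzWith (K' * 1) fun x : Space n × ℝ => G x.2 := hG.comp LipschitzWith.prod_snd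
  have hAn : ∀ p, LipschitzNear A p := fun p => LipschitzNear.of_lipschitzWith hA
  have hGn : ∀ p, LipschitzNear (fun x : Space n × ℝ => G x.2) p :=
    fun p => LipschitzNear.of_lipschitzWith hGs
  have hK : IsCompact (tsupport u) := hc
  set Fl : Space n × ℝ → Space n := fun x => A x (spaceGrad u x) with hFl
  have hFl0 : ∀ x, x ∉ tsupport u → Fl x = 0 := fun x hx => by
    rw [hFl]; simp only [spaceGrad_eq_zero hu hx, map_zero]
  have hdiv0 : ∀ x, x ∉ tsupport u → ∀ Z : Space n × ℝ → Space n,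
      (∀ y, y ∉ tsupport u → Z y = 0) → divergence Z x = 0 := by
    intro x hx Z hZ
    have : fderiv ℝ Z x = 0 := by
      rw [(eventuallyEq_zero_of_notMem hZ hx).fderiv_eq]; simp
    simp [divergence, this]
  -- Integrability of the two terms on the left.
  have i1 : Integrable (fun p => Real.exp (-n * logDist G p) * conjFun G β u p ^ 2) := by
    have h0 : ∀ x, x ∉ tsupport u →
        Real.exp (-n * logDist G x) * conjFun G β u x ^ 2 = 0 := fun x hx => by
      rw [conjFun_eq_zero hx]; simp
    refine Continuous.integrable_of_hasCompactSupport ?_ (HasCompactSupport.intro hK h0)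
    refine continuous_iff_continuousAt.2 fun x => LipschitzNear.continuousAt
      (lipschitzNear_of_support h0 (fun x hx => ?_) x)
    exact (lipschitzNear_exp_logDist (hGn x) (hpos x hx) _).mul
      ((lipschitzNear_conjFun (hGn x) (hpos x hx) hu).pow 2)
  have i2 : Integrable (fun p => Real.exp (-n * logDist G p) * (Real.exp (2 * logDist G p)
      * (conjFactor G β p ^ 2 * inner ℝ (A p (spaceGrad u p)) (spaceGrad u p)))) := by
    have h0 : ∀ x, x ∉ tsupport u → Real.exp (-n * logDist G x) * (Real.exp (2 * logDist G x)
        * (conjFactor G β x ^ 2 * inner ℝ (A x (spaceGrad u x)) (spaceGrad u x))) = 0 :=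
      fun x hx => by rw [spaceGrad_eq_zero hu hx]; simp
    refine Continuous.integrable_of_hasCompactSupport ?_ (HasCompactSupport.intro hK h0)
    refine continuous_iff_continuousAt.2 fun x => LipschitzNear.continuousAt
      (lipschitzNear_of_support h0 (fun x hx => ?_) x)
    have hU : LipschitzNear (spaceGrad u) x := LipschitzNear.of_contDiff (contDiff_spaceGrad hu)
    exact (lipschitzNear_exp_logDist (hGn x) (hpos x hx) _).mul
      ((lipschitzNear_exp_logDist (hGn x) (hpos x hx) _).mul
        (((lipschitzNear_conjFactor (hGn x) (hpos x hx)).pow 2).mul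
          (((hAn x).clm_apply hU).inner hU)))
  -- Integrability of the right-hand side: a bounded function times a weight that is continuous on
  -- the support of `u`.
  have i3 : Integrable (fun p => Real.exp (-n * logDist G p) * (Real.exp (2 * logDist G p)
      * conjFactor G β p * (divergence Fl p - timeDeriv u p)) ^ 2) := by
    obtain ⟨L, hL⟩ := LipschitzNear.exists_lipschitzWith (f := Fl)
      (fun p => (hAn p).clm_apply (LipschitzNear.of_contDiff (contDiff_spaceGrad hu)))
      (HasCompactSupport.intro hK hFl0)
    obtain ⟨C₁, hC₁⟩ := exists_bound_divergence hL
    obtain ⟨C₂, hC₂⟩ := (HasCompactSupport.intro hK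
      (fun x hx => timeDeriv_eq_zero hu hx)).exists_bound_of_continuous
        (contDiff_timeDeriv hu).continuous
    have hw : IntegrableOn (fun p => Real.exp (-n * logDist G p) * (Real.exp (2 * logDist G p)
        * conjFactor G β p) ^ 2) (tsupport u) := by
      refine ContinuousOn.integrableOn_compact hK fun x hx => ContinuousAt.continuousWithinAt ?_
      exact ((lipschitzNear_exp_logDist (hGn x) (hpos x hx) _).mul
        (((lipschitzNear_exp_logDist (hGn x) (hpos x hx) _).mul
          (lipschitzNear_conjFactor (hGn x) (hpos x hx))).pow 2)).continuousAt
    have hm : Measurable fun p => (divergence Fl p - timeDeriv u p) ^ 2 :=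
      ((measurable_divergence Fl).sub (contDiff_timeDeriv hu).continuous.measurable).pow_const 2
    have h1 : IntegrableOn (fun p => Real.exp (-n * logDist G p) * (Real.exp (2 * logDist G p)
        * conjFactor G β p) ^ 2 * (divergence Fl p - timeDeriv u p) ^ 2) (tsupport u) := by
      refine Integrable.mul_bdd (c := (C₁ + C₂) ^ 2) hw hm.aestronglyMeasurable
        (Eventually.of_forall fun x => ?_)
      rw [Real.norm_eq_abs, abs_pow]
      exact pow_le_pow_left₀ (abs_nonneg _)
        ((abs_sub _ _).trans (add_le_add (hC₁ x) (hC₂ x))) 2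
    refine ((integrableOn_iff_integrable_of_support_subset (fun x hx => ?_)).1 h1).congr
      (Eventually.of_forall fun x => ?_)
    · by_contra hx'
      apply hx
      simp only [hdiv0 x hx' Fl hFl0, timeDeriv_eq_zero hu hx']
      simp
    · simp only; ring
  refine ⟨i1, i2, i3, ?_⟩
  obtain ⟨iX, hX⟩ := integral_divergence_add_eq_zero
    (Z := carlemanField A G β u) (T := carlemanTime A G β u)
    (lipschitzNear_of_support (fun x hx => carlemanField_eq_zero hu hx)
      fun x hx => lipschitzNear_carlemanField (hAn x) (hGn x) (hpos x hx) hu)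
    (HasCompactSupport.intro hK fun x hx => carlemanField_eq_zero hu hx)
    (lipschitzNear_of_support (fun x hx => carlemanTime_eq_zero hu hx)
      fun x hx => lipschitzNear_carlemanTime (hAn x) (hGn x) (hpos x hx) hu)
    (HasCompactSupport.intro hK fun x hx => carlemanTime_eq_zero hu hx)
  have hae : ∀ᵐ p : Space n × ℝ, β ^ 3 * (Real.exp (-n * logDist G p) * conjFun G β u p ^ 2)
      + β * (Real.exp (-n * logDist G p) * (Real.exp (2 * logDist G p)
        * (conjFactor G β p ^ 2 * inner ℝ (A p (spaceGrad u p)) (spaceGrad u p))))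
      ≤ 16 * (Real.exp (-n * logDist G p) * (Real.exp (2 * logDist G p)
      * conjFactor G β p * (divergence Fl p - timeDeriv u p)) ^ 2)
      - 16 * (divergence (carlemanField A G β u) p
        + fderiv ℝ (carlemanTime A G β u) p (0, 1)) := by
    filter_upwards [hA.ae_differentiableAt, hGs.ae_differentiableAt] with p hpA hpG
    by_cases hp : p ∈ tsupport u
    · have hpG' : DifferentiableAt ℝ G p.2 := by
        have h1 : DifferentiableAt ℝ (fun x : Space n × ℝ => G x.2) (p.1, p.2) := hpG
        exact DifferentiableAt.comp (f := fun t : ℝ => (p.1, t)) p.2 h1 (by fun_prop)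
      have hreg : RegularAt A G p (fun w => fderiv ℝ A p w) (deriv G p.2) := by
        refine ⟨DerivativeAt.of_differentiableAt hpA, ?_, hsymmA p hp, hsymmG p hp, hpos p hp⟩
        refine ⟨(fderiv ℝ G p.2).comp (ContinuousLinearMap.snd ℝ _ _), ?_, fun w => ?_⟩
        · exact HasFDerivAt.comp p hpG'.hasFDerivAt hasFDerivAt_snd
        · simp
      have := carleman_pointwise (hb p hp hpA hpG') hreg hu (hr p hp) (hs p hp) (hsmall p hp)
        (hMr p hp) hβ
      refine le_trans (le_of_eq ?_) this
      ring
    · have e1 : fderiv ℝ (carlemanTime A G β u) p = 0 := by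
        rw [(eventuallyEq_zero_of_notMem (fun x hx => carlemanTime_eq_zero hu hx) hp).fderiv_eq]
        simp
      rw [hdiv0 p hp _ fun x hx => carlemanField_eq_zero hu hx, e1, conjFun_eq_zero hp,
        spaceGrad_eq_zero hu hp]
      simp only [map_zero, inner_zero_left, mul_zero, ne_eq, OfNat.ofNat_ne_zero,
        not_false_eq_true, zero_pow, add_zero, zero_apply, sub_zero]
      positivity
  have h := integral_mono_ae ((i1.const_mul (β ^ 3)).add (i2.const_mul β))
    ((i3.const_mul 16).sub (iX.const_mul 16)) hae
  rw [integral_add' (i1.const_mul (β ^ 3)) (i2.const_mul β),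
    integral_sub' (i3.const_mul 16) (iX.const_mul 16), integral_const_mul, integral_const_mul,
    integral_const_mul, integral_const_mul, hX, mul_zero, sub_zero] at h
  exact h

end Integration

/-! ### From matrices to operators -/

/-- The operator on `ℝⁿ` with a given matrix. -/
def matrixOp (B : Matrix (Fin n) (Fin n) ℝ) : Space n →L[ℝ] Space n :=
  Matrix.toEuclideanCLM (𝕜 := ℝ) B

theorem matrixOp_sub (B C : Matrix (Fin n) (Fin n) ℝ) :
    matrixOp (B - C) = matrixOp B - matrixOp C := map_sub _ _ _

theorem matrixOp_mul_apply (B C : Matrix (Fin n) (Fin n) ℝ) (ξ : Space n) :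
    matrixOp (B * C) ξ = matrixOp B (matrixOp C ξ) := by
  rw [matrixOp, map_mul]; rfl

theorem matrixOp_one_apply (ξ : Space n) : matrixOp (1 : Matrix (Fin n) (Fin n) ℝ) ξ = ξ := by
  rw [matrixOp, map_one]; rfl

theorem inner_matrixOp (B : Matrix (Fin n) (Fin n) ℝ) (ξ η : Space n) :
    inner ℝ (matrixOp B ξ) η
      = dotProduct (Matrix.mulVec B (WithLp.ofLp ξ)) (WithLp.ofLp η) := by
  rw [real_inner_comm, matrixOp, Matrix.inner_toEuclideanCLM, dotProduct_comm]

theorem inner_matrixOp_symm {B : Matrix (Fin n) (Fin n) ℝ} (hB : B.IsHermitian) (ξ η : Space n) :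
    inner ℝ (matrixOp B ξ) η = inner ℝ (matrixOp B η) ξ := by
  have hT : B.transpose = B := hB
  rw [inner_matrixOp, inner_matrixOp, dotProduct_comm, Matrix.dotProduct_mulVec,
    ← Matrix.mulVec_transpose, hT]

theorem norm_le_sum_coord (z : Space n) : ‖z‖ ≤ ∑ i : Fin n, |z i| := by
  have h : ∑ i : Fin n, z i • (EuclideanSpace.single i (1 : ℝ) : Space n) = z := by
    ext j
    simp [Finset.sum_apply, Pi.single_apply]
  calc ‖z‖ = ‖∑ i : Fin n, z i • (EuclideanSpace.single i (1 : ℝ) : Space n)‖ := by rw [h]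
    _ ≤ _ := (norm_sum_le _ _).trans_eq (by simp [norm_smul])

theorem norm_matrixOp_le {B : Matrix (Fin n) (Fin n) ℝ} {c : ℝ} (hc : 0 ≤ c)
    (hB : ∀ i j, |B i j| ≤ c) : ‖matrixOp B‖ ≤ n ^ 2 * c := by
  refine ContinuousLinearMap.opNorm_le_bound _ (by positivity) fun ξ => ?_
  refine (norm_le_sum_coord _).trans ?_
  calc ∑ i : Fin n, |(matrixOp B ξ) i| ≤ ∑ _i : Fin n, ∑ _j : Fin n, c * ‖ξ‖ := by
        refine Finset.sum_le_sum fun i _ => ?_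
        have e : (matrixOp B ξ) i = ∑ j, B i j * ξ j := rfl
        rw [e]
        refine (Finset.abs_sum_le_sum_abs _ _).trans (Finset.sum_le_sum fun j _ => ?_)
        rw [abs_mul]
        exact mul_le_mul (hB i j) (PiLp.norm_apply_le ξ j) (abs_nonneg _) hc
    _ = n ^ 2 * c * ‖ξ‖ := by simp; ring

section Elliptic

variable {Λ : ℝ} {B : Matrix (Fin n) (Fin n) ℝ}

theorem inner_matrixOp_self_nonneg {B : Matrix (Fin n) (Fin n) ℝ} (hB : B.PosSemidef)
    (ξ : Space n) : 0 ≤ inner ℝ (matrixOp B ξ) ξ := by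
  rw [inner_matrixOp, dotProduct_comm]
  simpa using hB.dotProduct_mulVec_nonneg (WithLp.ofLp ξ)

theorem matrixOp_smul_one_apply (c : ℝ) (ξ : Space n) :
    matrixOp (c • (1 : Matrix (Fin n) (Fin n) ℝ)) ξ = c • ξ := by
  rw [matrixOp, map_smul, map_one]; rfl

variable (hΛ : 1 < Λ) (h1 : (B - Λ⁻¹ • (1 : Matrix (Fin n) (Fin n) ℝ)).PosSemidef)
  (h2 : (Λ • (1 : Matrix (Fin n) (Fin n) ℝ) - B).PosSemidef)

include h1 in
theorem elliptic_isHermitian : B.IsHermitian := by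
  have h : (Λ⁻¹ • (1 : Matrix (Fin n) (Fin n) ℝ)).IsHermitian := by
    rw [Matrix.IsHermitian, Matrix.conjTranspose_smul, Matrix.conjTranspose_one, star_trivial]
  simpa using h1.isHermitian.add h

include hΛ h1 in
theorem elliptic_lower (ξ : Space n) : ‖ξ‖ ^ 2 ≤ Λ * inner ℝ (matrixOp B ξ) ξ := by
  have h := inner_matrixOp_self_nonneg h1 ξ
  rw [matrixOp_sub, sub_apply, matrixOp_smul_one_apply, inner_sub_left,
    inner_smul_left, real_inner_self_eq_norm_sq] at h
  simp only [conj_trivial] at h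
  have hp : 0 < Λ := by linarith
  have := mul_le_mul_of_nonneg_left (sub_nonneg.1 h) hp.le
  rwa [← mul_assoc, mul_inv_cancel₀ hp.ne', one_mul] at this

include h2 in
theorem elliptic_upper (ξ : Space n) : inner ℝ (matrixOp B ξ) ξ ≤ Λ * ‖ξ‖ ^ 2 := by
  have h := inner_matrixOp_self_nonneg h2 ξ
  rw [matrixOp_sub, sub_apply, matrixOp_smul_one_apply, inner_sub_left,
    inner_smul_left, real_inner_self_eq_norm_sq] at h
  simpa using h

include hΛ h1 h2 in
theorem elliptic_norm_le (ξ : Space n) : ‖matrixOp B ξ‖ ≤ Λ * ‖ξ‖ := by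
  have hp : 0 < Λ := by linarith
  have hsymm := inner_matrixOp_symm (elliptic_isHermitian h1)
  -- Positivity of the form at `Λξ - Bξ`.
  have h0 : 0 ≤ inner ℝ (matrixOp B (Λ • ξ - matrixOp B ξ)) (Λ • ξ - matrixOp B ξ) := by
    have := elliptic_lower hΛ h1 (Λ • ξ - matrixOp B ξ)
    have h3 := sq_nonneg ‖Λ • ξ - matrixOp B ξ‖
    exact nonneg_of_mul_nonneg_right (h3.trans this) hp
  have h3 := elliptic_upper h2 (matrixOp B ξ)
  have h4 := elliptic_upper h2 ξ
  simp only [map_sub, map_smul, inner_sub_left, inner_sub_right, inner_smul_left,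
    inner_smul_right, conj_trivial, real_inner_self_eq_norm_sq] at h0
  rw [hsymm (matrixOp B ξ) ξ, real_inner_self_eq_norm_sq] at h0
  have h5 : ‖matrixOp B ξ‖ ^ 2 ≤ (Λ * ‖ξ‖) ^ 2 := by
    have h6 := mul_le_mul_of_nonneg_left h4 (sq_nonneg Λ)
    have h7 : Λ * ‖matrixOp B ξ‖ ^ 2 ≤ Λ * (Λ * ‖ξ‖) ^ 2 := by nlinarith
    exact le_of_mul_le_mul_left h7 hp
  exact le_of_sq_le_sq h5 (by positivity)

include hΛ h1 in
theorem elliptic_mul_inv : B * B⁻¹ = 1 ∧ B⁻¹ * B = 1 := by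
  have hp : 0 < Λ⁻¹ := inv_pos.2 (by linarith)
  have hpd : B.PosDef := by
    have h := Matrix.PosDef.posSemidef_add h1
      ((Matrix.PosDef.one (n := Fin n) (R := ℝ)).smul hp)
    simpa using h
  have hu : IsUnit B.det := (Matrix.isUnit_iff_isUnit_det B).1 hpd.isUnit
  exact ⟨Matrix.mul_nonsing_inv B hu, Matrix.nonsing_inv_mul B hu⟩

include hΛ h1 in
theorem elliptic_inv_apply (ξ : Space n) : matrixOp B (matrixOp B⁻¹ ξ) = ξ := by
  rw [← matrixOp_mul_apply, (elliptic_mul_inv hΛ h1).1, matrixOp_one_apply]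

include hΛ h1 in
theorem elliptic_inv_norm_le (ξ : Space n) : ‖matrixOp B⁻¹ ξ‖ ≤ Λ * ‖ξ‖ := by
  have h := elliptic_lower hΛ h1 (matrixOp B⁻¹ ξ)
  rw [elliptic_inv_apply hΛ h1] at h
  have h3 := real_inner_le_norm ξ (matrixOp B⁻¹ ξ)
  have hp : 0 < Λ := by linarith
  by_cases h0 : ‖matrixOp B⁻¹ ξ‖ = 0
  · rw [h0]; positivity
  · have hpos : 0 < ‖matrixOp B⁻¹ ξ‖ := lt_of_le_of_ne (norm_nonneg _) (Ne.symm h0)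
    refine le_of_mul_le_mul_right ?_ hpos
    nlinarith [mul_le_mul_of_nonneg_left h3 hp.le]

include hΛ h1 h2 in
theorem elliptic_inv_coercive (ξ : Space n) :
    ‖ξ‖ ^ 2 ≤ Λ ^ 3 * inner ℝ (matrixOp B⁻¹ ξ) ξ := by
  have h := elliptic_lower hΛ h1 (matrixOp B⁻¹ ξ)
  have h3 := elliptic_norm_le hΛ h1 h2 (matrixOp B⁻¹ ξ)
  rw [elliptic_inv_apply hΛ h1] at h h3
  rw [real_inner_comm] at h
  calc ‖ξ‖ ^ 2 ≤ (Λ * ‖matrixOp B⁻¹ ξ‖) ^ 2 := pow_le_pow_left₀ (norm_nonneg _) h3 2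
    _ = Λ ^ 2 * ‖matrixOp B⁻¹ ξ‖ ^ 2 := by ring
    _ ≤ Λ ^ 2 * (Λ * inner ℝ (matrixOp B⁻¹ ξ) ξ) := by gcongr
    _ = _ := by ring

include hΛ h1 in
theorem norm_matrixOp_inv_sub_inv_le {C : Matrix (Fin n) (Fin n) ℝ}
    (h1' : (C - Λ⁻¹ • (1 : Matrix (Fin n) (Fin n) ℝ)).PosSemidef) {d : ℝ}
    (hd : ‖matrixOp (C - B)‖ ≤ d) : ‖matrixOp B⁻¹ - matrixOp C⁻¹‖ ≤ Λ ^ 2 * d := by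
  have hp : 0 < Λ := by linarith
  have hd0 : 0 ≤ d := (norm_nonneg _).trans hd
  refine ContinuousLinearMap.opNorm_le_bound _ (by positivity) fun ξ => ?_
  have e : B⁻¹ - C⁻¹ = B⁻¹ * (C - B) * C⁻¹ := by
    rw [mul_sub, sub_mul, mul_assoc, (elliptic_mul_inv hΛ h1').1, (elliptic_mul_inv hΛ h1).2,
      mul_one, one_mul]
  rw [← matrixOp_sub, e, matrixOp_mul_apply, matrixOp_mul_apply]
  calc _ ≤ Λ * ‖matrixOp (C - B) (matrixOp C⁻¹ ξ)‖ := elliptic_inv_norm_le hΛ h1 _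
    _ ≤ Λ * (d * (Λ * ‖ξ‖)) := by
      gcongr
      exact (ContinuousLinearMap.le_of_opNorm_le _ hd _).trans
        (by gcongr; exact elliptic_inv_norm_le hΛ h1' _)
    _ = _ := by ring

end Elliptic

theorem isOpen_spaceTimeCylinder (R T : ℝ) : IsOpen (spaceTimeCylinder n R T) :=
  isOpen_ball.prod isOpen_Ioo

section Cylinder

variable {Λ K R T : ℝ} {A : Space n × ℝ → Matrix (Fin n) (Fin n) ℝ}

theorem norm_matrixOp_sub_le (hK : 0 ≤ K)
    (hL : LipschitzCoefficients K A (spaceTimeCylinder n R T)) {p q : Space n × ℝ}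
    (hp : p ∈ spaceTimeCylinder n R T) (hq : q ∈ spaceTimeCylinder n R T) :
    ‖matrixOp (A p - A q)‖ ≤ n ^ 2 * (K * (‖p.1 - q.1‖ + |p.2 - q.2|)) :=
  norm_matrixOp_le (by positivity) fun i j => hL p hp q hq i j

theorem lipschitzOnWith_matrixOp (hK : 0 ≤ K)
    (hL : LipschitzCoefficients K A (spaceTimeCylinder n R T)) :
    LipschitzOnWith (2 * n ^ 2 * K).toNNReal (fun p => matrixOp (A p))
      (spaceTimeCylinder n R T) := by
  refine LipschitzOnWith.of_dist_le_mul fun p hp q hq => ?_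
  rw [Real.coe_toNNReal _ (by positivity), dist_eq_norm, dist_eq_norm, ← matrixOp_sub]
  refine (norm_matrixOp_sub_le hK hL hp hq).trans ?_
  have e1 : ‖p.1 - q.1‖ ≤ ‖p - q‖ := norm_fst_le (p - q)
  have e2 : |p.2 - q.2| ≤ ‖p - q‖ := norm_snd_le (p - q)
  calc _ ≤ n ^ 2 * (K * (‖p - q‖ + ‖p - q‖)) := by gcongr
    _ = _ := by ring

theorem lipschitzOnWith_inv (hΛ : 1 < Λ) (hK : 0 ≤ K) (hR : 0 < R)
    (hE : UniformlyElliptic Λ A (spaceTimeCylinder n R T))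
    (hL : LipschitzCoefficients K A (spaceTimeCylinder n R T)) :
    LipschitzOnWith (Λ ^ 2 * (n ^ 2 * K)).toNNReal (fun t => matrixOp (A (0, t))⁻¹)
      (Ioo (-T) T) := by
  refine LipschitzOnWith.of_dist_le_mul fun t ht s hs => ?_
  rw [Real.coe_toNNReal _ (by positivity), dist_eq_norm, Real.dist_eq]
  have hmem : ∀ r ∈ Ioo (-T) T, ((0 : Space n), r) ∈ spaceTimeCylinder n R T :=
    fun r hr => ⟨mem_ball_self hR, hr⟩
  have h := norm_matrixOp_sub_le hK hL (hmem s hs) (hmem t ht)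
  refine (norm_matrixOp_inv_sub_inv_le hΛ (hE _ (hmem t ht)).1 (hE _ (hmem s hs)).1 h).trans_eq ?_
  simp only [sub_self, norm_zero, zero_add, abs_sub_comm s t]
  ring

end Cylinder

/-- Divergence through line derivatives, as in the definition of `divOp`, agrees with `divergence`
at points of differentiability. -/
theorem spaceDiv_eq_divergence {F F' : Space n × ℝ → Space n} {p : Space n × ℝ}
    (h : F =ᶠ[𝓝 p] F') (hd : DifferentiableAt ℝ F' p) : spaceDiv F p = divergence F' p := by
  unfold spaceDiv divergence
  refine Finset.sum_congr rfl fun i _ => ?_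
  have ht : Tendsto (fun y : Space n => (y, p.2)) (𝓝 p.1) (𝓝 p) :=
    (Continuous.prodMk_left p.2).tendsto' _ _ rfl
  have h1 : (fun y => F (y, p.2) i) =ᶠ[𝓝 p.1] fun y => F' (y, p.2) i :=
    (ht.eventually h).mono fun y hy => by
      have hy' : F (y, p.2) = F' (y, p.2) := hy
      simp only [hy']
  rw [h1.lineDeriv_eq]
  have h2 : HasFDerivAt F' (fderiv ℝ F' p) (p.1, p.2) := hd.hasFDerivAt
  have h3 := HasFDerivAt.comp (f := fun y : Space n => (y, p.2)) p.1 h2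
    (hasFDerivAt_prodMk_left p.1 p.2)
  have h4 := ((EuclideanSpace.proj i : Space n →L[ℝ] ℝ).hasFDerivAt.comp p.1 h3)
  exact (h4.hasLineDerivAt (EuclideanSpace.single i 1)).lineDeriv

/-! ### The estimate for matrix coefficients -/

theorem sigma_eq_exp_logDist {A : Space n × ℝ → Matrix (Fin n) (Fin n) ℝ}
    {G : ℝ → Space n →L[ℝ] Space n} {p : Space n × ℝ}
    (hG : G p.2 = matrixOp (A (0, p.2))⁻¹) (hq : 0 < quadDist G p) :
    sigma A p = Real.exp (logDist G p) := by
  have h : Real.exp (logDist G p) ^ 2 = quadDist G p := by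
    rw [← exp_logDist hq, ← Real.exp_nat_mul]; simp
  rw [sigma, ← inner_matrixOp, ← hG]
  change Real.sqrt (quadDist G p) = _
  rw [← h, Real.sqrt_sq (Real.exp_pos _).le]

theorem weight_eq {A : Space n × ℝ → Matrix (Fin n) (Fin n) ℝ}
    {G : ℝ → Space n →L[ℝ] Space n} {p : Space n × ℝ} (β : ℝ) (k : ℤ)
    (hG : G p.2 = matrixOp (A (0, p.2))⁻¹) (hq : 0 < quadDist G p) :
    weight A β k p = Real.exp (-n * logDist G p) * Real.exp (k * logDist G p)
      * conjFactor G β p ^ 2 := by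
  rw [weight, sigma_eq_exp_logDist hG hq, Real.log_exp, ← Real.rpow_intCast, ← Real.exp_mul,
    conjFactor, ← Real.exp_nat_mul]
  simp only [← Real.exp_add]
  congr 1
  push_cast
  ring

/-- The Carleman estimate on a cylinder, for coefficients replaced by globally Lipschitz
extensions `Ã` of `A` and `G` of `t ↦ A(0,t)⁻¹`. -/
theorem carleman_of_extension {Λ K M β R T : ℝ} {A : Space n × ℝ → Matrix (Fin n) (Fin n) ℝ}
    {Ã : Space n × ℝ → Space n →L[ℝ] Space n} {G : ℝ → Space n →L[ℝ] Space n}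
    {u : Space n × ℝ → ℝ} {L L' : NNReal}
    (hΛ : 1 < Λ) (hK : 0 ≤ K) (hM : M = Λ ^ 3 + 2 * n ^ 2 * K * Λ ^ 2) (hR : 0 < R)
    (hrad : ∀ r : ℝ, 0 < r → r ≤ R → ∀ a : ℝ, r ^ 2 ≤ M * a → a ≤ M * r ^ 2 →
      r ≤ 1 ∧ (1 / 2) * Real.log a ≤ -1 ∧
        (25 + 10 * n) * M ^ 8 * (r * |(1 / 2) * Real.log a|) ≤ 1 / 8 ∧ M ^ 3 * r ≤ 1 / 10)
    (hβ : 8 + 4 * ((n : ℝ) - 2) ^ 2 + 8 * (6 + 3 * n * M ^ 2) ^ 2 ≤ β)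
    (hE : UniformlyElliptic Λ A (spaceTimeCylinder n R T))
    (hL : LipschitzCoefficients K A (spaceTimeCylinder n R T))
    (hu : ContDiff ℝ ∞ u) (hc : HasCompactSupport u)
    (hsub : tsupport u ⊆ (ball (0 : Space n) R \ {0}) ×ˢ Ioo (-T) T)
    (hÃ : LipschitzWith L Ã) (hG : LipschitzWith L' G)
    (hÃA : EqOn (fun p => matrixOp (A p)) Ã (spaceTimeCylinder n R T))
    (hGA : EqOn (fun t => matrixOp (A (0, t))⁻¹) G (Ioo (-T) T)) :
    IntegrableOn (fun p => weight A β 0 p * u p ^ 2) (spaceTimeCylinder n R T) ∧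
    IntegrableOn (fun p => weight A β 2 p * inner ℝ (flux A u p) (spaceGrad u p))
      (spaceTimeCylinder n R T) ∧
    IntegrableOn (fun p => weight A β 4 p * (divOp A u p - timeDeriv u p) ^ 2)
      (spaceTimeCylinder n R T) ∧
    β ^ 3 * (∫ p in spaceTimeCylinder n R T, weight A β 0 p * u p ^ 2)
      + β * (∫ p in spaceTimeCylinder n R T,
          weight A β 2 p * inner ℝ (flux A u p) (spaceGrad u p))
      ≤ 16 * (∫ p in spaceTimeCylinder n R T,
          weight A β 4 p * (divOp A u p - timeDeriv u p) ^ 2) := by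
  set Q := spaceTimeCylinder n R T with hQdef
  have hQo : IsOpen Q := isOpen_spaceTimeCylinder R T
  have hQm : MeasurableSet Q := hQo.measurableSet
  have hsubQ : tsupport u ⊆ Q := fun p hp => ⟨(hsub hp).1.1, (hsub hp).2⟩
  have hΛ0 : 0 < Λ := by linarith
  have hnK : 0 ≤ 2 * (n : ℝ) ^ 2 * K := by positivity
  have hΛ2 : Λ ^ 2 ≤ Λ ^ 3 := pow_le_pow_right₀ hΛ.le (by norm_num)
  have hM3 : Λ ^ 3 ≤ M := by rw [hM]; have := mul_nonneg hnK (sq_nonneg Λ); linarith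
  have hMK : 2 * n ^ 2 * K * Λ ^ 2 ≤ M := by rw [hM]; have := pow_pos hΛ0 3; linarith
  have hM1 : 1 ≤ M := (one_le_pow₀ hΛ.le).trans hM3
  have hMΛ : Λ ≤ M := (le_self_pow₀ hΛ.le (by norm_num)).trans hM3
  have hMK1 : 2 * n ^ 2 * K ≤ M :=
    (le_mul_of_one_le_right hnK (one_le_pow₀ hΛ.le)).trans hMK
  have hMK2 : n ^ 2 * K * Λ ≤ M := by
    refine le_trans ?_ hMK
    have h1 : (n : ℝ) ^ 2 * K * Λ ≤ n ^ 2 * K * Λ ^ 2 := by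
      gcongr; exact le_self_pow₀ hΛ.le (by norm_num)
    have h2 : 0 ≤ (n : ℝ) ^ 2 * K * Λ ^ 2 := by positivity
    linarith
  have hMK3 : Λ ^ 2 * (n ^ 2 * K) ≤ M := by
    refine le_trans ?_ hMK
    have h2 : 0 ≤ (n : ℝ) ^ 2 * K * Λ ^ 2 := by positivity
    linarith
  have h0Q : ∀ p ∈ Q, ((0 : Space n), p.2) ∈ Q := fun p hp => ⟨mem_ball_self hR, hp.2⟩
  have eA : ∀ p ∈ Q, Ã p = matrixOp (A p) := fun p hp => (hÃA hp).symm
  have eG : ∀ p ∈ Q, G p.2 = matrixOp (A (0, p.2))⁻¹ := fun p hp => (hGA hp.2).symm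
  have cG : ∀ p ∈ Q, ∀ ξ, ‖ξ‖ ^ 2 ≤ M * inner ℝ (G p.2 ξ) ξ := fun p hp ξ => by
    have h := elliptic_inv_coercive hΛ (hE _ (h0Q p hp)).1 (hE _ (h0Q p hp)).2 ξ
    rw [eG p hp]
    have h0 : 0 ≤ inner ℝ (matrixOp (A (0, p.2))⁻¹ ξ) ξ :=
      nonneg_of_mul_nonneg_right ((sq_nonneg _).trans h) (by positivity)
    exact h.trans (by gcongr)
  have nG : ∀ p ∈ Q, ∀ ξ, ‖G p.2 ξ‖ ≤ M * ‖ξ‖ := fun p hp ξ => by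
    rw [eG p hp]
    exact (elliptic_inv_norm_le hΛ (hE _ (h0Q p hp)).1 ξ).trans (by gcongr)
  have hx0 : ∀ p ∈ tsupport u, 0 < ‖p.1‖ := fun p hp => norm_pos_iff.2 (hsub hp).1.2
  have hpos : ∀ p ∈ tsupport u, 0 < quadDist G p := fun p hp => by
    have h1 := cG p (hsubQ hp) p.1
    have h2 : 0 < M * inner ℝ (G p.2 p.1) p.1 := lt_of_lt_of_le (by have := hx0 p hp; positivity) h1
    exact (pos_iff_pos_of_mul_pos h2).1 (by linarith)
  have hball : ∀ p ∈ tsupport u, ‖p.1‖ ≤ R := fun p hp =>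
    (mem_ball_zero_iff.1 (hsub hp).1.1).le
  have hradp : ∀ p ∈ tsupport u, ‖p.1‖ ≤ 1 ∧ logDist G p ≤ -1 ∧
      (25 + 10 * n) * M ^ 8 * (‖p.1‖ * |logDist G p|) ≤ 1 / 8 ∧ M ^ 3 * ‖p.1‖ ≤ 1 / 10 :=
    fun p hp => hrad ‖p.1‖ (hx0 p hp) (hball p hp) (quadDist G p) (cG p (hsubQ hp) p.1) (by
      have h1 := abs_inner_le_of_le (nG p (hsubQ hp) p.1) le_rfl (y := p.1)
      have h2 := (le_abs_self _).trans h1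
      exact h2.trans_eq (by ring))
  have hbd : ∀ p ∈ tsupport u, DifferentiableAt ℝ Ã p → DifferentiableAt ℝ G p.2 →
      BoundedAt M Ã G p (fun w => fderiv ℝ Ã p w) (deriv G p.2) := by
    intro p hp hdA hdG
    have hpQ := hsubQ hp
    have hLA : LipschitzOnWith (2 * n ^ 2 * K).toNNReal Ã Q :=
      fun x hx y hy => by
        rw [← hÃA hx, ← hÃA hy]
        exact lipschitzOnWith_matrixOp hK hL hx hy
    have hLG : LipschitzOnWith (Λ ^ 2 * (n ^ 2 * K)).toNNReal G (Ioo (-T) T) :=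
      fun x hx y hy => by
        rw [← hGA hx, ← hGA hy]
        exact lipschitzOnWith_inv hΛ hK hR hE hL hx hy
    have hA' : ‖fderiv ℝ Ã p‖ ≤ M := by
      have := hdA.hasFDerivAt.le_of_lipschitzOn (hQo.mem_nhds hpQ) hLA
      rw [Real.coe_toNNReal _ hnK] at this
      exact this.trans hMK1
    have hG' : ‖deriv G p.2‖ ≤ M := by
      have := norm_deriv_le_of_lipschitzOn (isOpen_Ioo.mem_nhds hpQ.2) hLG
      rw [Real.coe_toNNReal _ (by positivity)] at this
      exact this.trans hMK3
    refine ⟨hM1, fun ξ => ?_, nG p hpQ, fun ξ => ?_, cG p hpQ, fun ξ => ?_, fun ζ ξ => ?_,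
      fun ξ => ?_, fun ξ => ?_⟩
    · rw [eA p hpQ]
      exact (elliptic_norm_le hΛ (hE p hpQ).1 (hE p hpQ).2 ξ).trans (by gcongr)
    · rw [eA p hpQ]
      have h := elliptic_lower hΛ (hE p hpQ).1 ξ
      have h0 : 0 ≤ inner ℝ (matrixOp (A p) ξ) ξ :=
        nonneg_of_mul_nonneg_right ((sq_nonneg _).trans h) hΛ0
      exact h.trans (by gcongr)
    · have hinv := elliptic_inv_apply hΛ (hE _ (h0Q p hpQ)).1 ξ
      rw [eA p hpQ, eG p hpQ]
      nth_rewrite 2 [← hinv]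
      rw [← sub_apply, ← matrixOp_sub]
      have h1 := norm_matrixOp_sub_le hK hL hpQ (h0Q p hpQ)
      simp only [sub_zero, sub_self, abs_zero, add_zero] at h1
      calc _ ≤ n ^ 2 * (K * ‖p.1‖) * ‖matrixOp (A (0, p.2))⁻¹ ξ‖ :=
            ContinuousLinearMap.le_of_opNorm_le _ h1 _
        _ ≤ n ^ 2 * (K * ‖p.1‖) * (Λ * ‖ξ‖) := by
            gcongr; exact elliptic_inv_norm_le hΛ (hE _ (h0Q p hpQ)).1 ξ
        _ = n ^ 2 * K * Λ * ‖p.1‖ * ‖ξ‖ := by ring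
        _ ≤ _ := by gcongr
    · refine ContinuousLinearMap.le_of_opNorm_le _ ?_ ξ
      refine ((fderiv ℝ Ã p).le_of_opNorm_le hA' _).trans_eq ?_
      simp
    · refine ContinuousLinearMap.le_of_opNorm_le _ ?_ ξ
      refine ((fderiv ℝ Ã p).le_of_opNorm_le hA' _).trans_eq ?_
      simp
    · exact ContinuousLinearMap.le_of_opNorm_le _ hG' ξ
  obtain ⟨i1, i2, i3, hineq⟩ := integrated_carleman (M := M) (β := β) hÃ hG hu hc hpos
    (fun p hp => by
      rw [eA p (hsubQ hp)]
      exact inner_matrixOp_symm (elliptic_isHermitian (hE p (hsubQ hp)).1))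
    (fun p hp => by
      rw [eG p (hsubQ hp)]
      exact inner_matrixOp_symm (elliptic_isHermitian (hE _ (h0Q p (hsubQ hp))).1).inv)
    hbd (fun p hp => (hradp p hp).1) (fun p hp => (hradp p hp).2.1)
    (fun p hp => (hradp p hp).2.2.1) (fun p hp => (hradp p hp).2.2.2) hβ
  have hflux : ∀ p ∈ Q, flux A u p = Ã p (spaceGrad u p) := fun p hp => by
    rw [eA p hp]; rfl
  -- On the cylinder the integrands agree with those of the estimate for the extensions.
  have c1 : ∀ p ∈ Q, weight A β 0 p * u p ^ 2
      = Real.exp (-n * logDist G p) * conjFun G β u p ^ 2 := by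
    intro p hp
    by_cases hpu : p ∈ tsupport u
    · rw [weight_eq β 0 (eG p hp) (hpos p hpu), conjFun]
      simp only [Int.cast_zero, zero_mul, Real.exp_zero]
      ring
    · rw [conjFun_eq_zero hpu, image_eq_zero_of_notMem_tsupport hpu]; simp
  have c2 : ∀ p ∈ Q, weight A β 2 p * inner ℝ (flux A u p) (spaceGrad u p)
      = Real.exp (-n * logDist G p) * (Real.exp (2 * logDist G p)
        * (conjFactor G β p ^ 2 * inner ℝ (Ã p (spaceGrad u p)) (spaceGrad u p))) := by
    intro p hp
    by_cases hpu : p ∈ tsupport u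
    · rw [weight_eq β 2 (eG p hp) (hpos p hpu), hflux p hp]
      push_cast
      ring
    · rw [spaceGrad_eq_zero hu hpu]; simp
  have c3 : ∀ᵐ p : Space n × ℝ, p ∈ Q → weight A β 4 p * (divOp A u p - timeDeriv u p) ^ 2
      = Real.exp (-n * logDist G p) * (Real.exp (2 * logDist G p) * conjFactor G β p *
        (divergence (fun x => Ã x (spaceGrad u x)) p - timeDeriv u p)) ^ 2 := by
    filter_upwards [hÃ.ae_differentiableAt] with p hpd hp
    have hev : flux A u =ᶠ[𝓝 p] fun x => Ã x (spaceGrad u x) :=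
      mem_of_superset (hQo.mem_nhds hp) hflux
    have hdiv : divOp A u p = divergence (fun x => Ã x (spaceGrad u x)) p :=
      spaceDiv_eq_divergence hev
        (hpd.clm_apply ((contDiff_spaceGrad hu).differentiable (by simp) p))
    rw [hdiv]
    by_cases hpu : p ∈ tsupport u
    · rw [weight_eq β 4 (eG p hp) (hpos p hpu)]
      have e4 : Real.exp (((4 : ℤ) : ℝ) * logDist G p) = Real.exp (2 * logDist G p) ^ 2 := by
        rw [← Real.exp_nat_mul]; congr 1; push_cast; ring
      rw [e4]
      ring
    · have hz : divergence (fun x => Ã x (spaceGrad u x)) p = 0 := by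
        have h1 : (fun x => Ã x (spaceGrad u x)) =ᶠ[𝓝 p] fun _ => 0 :=
          eventuallyEq_zero_of_notMem (fun x hx => by rw [spaceGrad_eq_zero hu hx, map_zero]) hpu
        simp [divergence, h1.fderiv_eq]
      rw [hz, timeDeriv_eq_zero hu hpu]; simp
  have z1 : ∀ p, p ∉ Q → Real.exp (-n * logDist G p) * conjFun G β u p ^ 2 = 0 := fun p hp => by
    rw [conjFun_eq_zero fun h => hp (hsubQ h)]; simp
  have z2 : ∀ p, p ∉ Q → Real.exp (-n * logDist G p) * (Real.exp (2 * logDist G p)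
      * (conjFactor G β p ^ 2 * inner ℝ (Ã p (spaceGrad u p)) (spaceGrad u p))) = 0 :=
    fun p hp => by rw [spaceGrad_eq_zero hu fun h => hp (hsubQ h)]; simp
  have z3 : ∀ p, p ∉ Q → Real.exp (-n * logDist G p) * (Real.exp (2 * logDist G p)
      * conjFactor G β p * (divergence (fun x => Ã x (spaceGrad u x)) p - timeDeriv u p)) ^ 2
      = 0 := fun p hp => by
    have hpu : p ∉ tsupport u := fun h => hp (hsubQ h)
    have h1 : (fun x => Ã x (spaceGrad u x)) =ᶠ[𝓝 p] fun _ => 0 :=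
      eventuallyEq_zero_of_notMem (fun x hx => by rw [spaceGrad_eq_zero hu hx, map_zero]) hpu
    simp [divergence, h1.fderiv_eq, timeDeriv_eq_zero hu hpu]
  refine ⟨i1.integrableOn.congr_fun (fun p hp => (c1 p hp).symm) hQm,
    i2.integrableOn.congr_fun (fun p hp => (c2 p hp).symm) hQm,
    i3.integrableOn.congr_fun_ae ?_, ?_⟩
  · exact (ae_restrict_iff' hQm).2 (c3.mono fun p hp hpQ => (hp hpQ).symm)
  · rw [setIntegral_congr_fun hQm c1, setIntegral_congr_fun hQm c2,
      setIntegral_congr_ae hQm c3,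
      setIntegral_eq_integral_of_forall_compl_eq_zero z1,
      setIntegral_eq_integral_of_forall_compl_eq_zero z2,
      setIntegral_eq_integral_of_forall_compl_eq_zero z3]
    exact hineq

end ParabolicCarleman

end

theorem theorem3p10 (n : ℕ) (Λ K : ℝ) (hΛ : 1 < Λ) (hK : 0 ≤ K) :
    ∃ C > (0 : ℝ), ∃ β₀ > (0 : ℝ), ∃ R₀ > (0 : ℝ),
      ∀ β : ℝ, β₀ ≤ β →
      ∀ R T : ℝ, 0 < R → R ≤ R₀ → 0 < T →
      ∀ A : Space n × ℝ → Matrix (Fin n) (Fin n) ℝ,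
        UniformlyElliptic Λ A (spaceTimeCylinder n R T) →
        LipschitzCoefficients K A (spaceTimeCylinder n R T) →
      ∀ u : Space n × ℝ → ℝ,
        ContDiff ℝ ∞ u → HasCompactSupport u →
        tsupport u ⊆ (ball (0 : Space n) R \ {0}) ×ˢ Ioo (-T) T →
        IntegrableOn (fun p => weight A β 0 p * u p ^ 2) (spaceTimeCylinder n R T) ∧
        IntegrableOn (fun p => weight A β 2 p * inner ℝ (flux A u p) (spaceGrad u p))
          (spaceTimeCylinder n R T) ∧
        IntegrableOn (fun p => weight A β 4 p * (divOp A u p - timeDeriv u p) ^ 2)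
          (spaceTimeCylinder n R T) ∧
        β ^ 3 * (∫ p in spaceTimeCylinder n R T, weight A β 0 p * u p ^ 2)
          + β * (∫ p in spaceTimeCylinder n R T,
              weight A β 2 p * inner ℝ (flux A u p) (spaceGrad u p))
          ≤ C * (∫ p in spaceTimeCylinder n R T,
              weight A β 4 p * (divOp A u p - timeDeriv u p) ^ 2) := by
  have hM1 : 1 ≤ Λ ^ 3 + 2 * n ^ 2 * K * Λ ^ 2 := by
    have h1 : 1 ≤ Λ ^ 3 := one_le_pow₀ hΛ.le
    have h2 : 0 ≤ 2 * (n : ℝ) ^ 2 * K * Λ ^ 2 := by positivity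
    linarith
  obtain ⟨R₀, hR₀, hrad⟩ := exists_radius (Λ ^ 3 + 2 * n ^ 2 * K * Λ ^ 2)
    ((25 + 10 * n) * (Λ ^ 3 + 2 * n ^ 2 * K * Λ ^ 2) ^ 8) hM1 (by positivity)
  refine ⟨16, by norm_num, 8 + 4 * ((n : ℝ) - 2) ^ 2
    + 8 * (6 + 3 * n * (Λ ^ 3 + 2 * n ^ 2 * K * Λ ^ 2) ^ 2) ^ 2, by positivity, R₀, hR₀, ?_⟩
  intro β hβ R T hR hRR₀ _ A hE hL u hu hc hsub
  obtain ⟨Ã, hÃ, hÃA⟩ := (lipschitzOnWith_matrixOp hK hL).extend_finite_dimension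
  obtain ⟨G, hG, hGA⟩ := (lipschitzOnWith_inv hΛ hK hR hE hL).extend_finite_dimension
  exact carleman_of_extension hΛ hK rfl hR
    (fun r h0 hr a h1 h2 => hrad r h0 (hr.trans hRR₀) a h1 h2) hβ hE hL hu hc hsub hÃ hG hÃA hGA
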